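/- Let $\mathcal X$ be a semi-abelian category (pointed, Barr-exact, Bourn-protomodular, with binary coproducts), let $n\ge 1$, let $Z$ be an object of $\mathcal X$ and let $A$ be an abelian object of $\mathcal X$, i.e. an internal abelian group. *Simplicial notions.* An augmented simplicial object $\mathbb X=(\mathbb X_m)_{m\ge -1}$ in $\mathcal X$ is a functor $(\Delta^+)^{\mathrm{op}}\to\mathcal X$, where $\Delta^+$ is the category of finite ordinals $k=\{0,\dots,k-1\}$, $k\ge 0$, and order preserving maps; $\mathbb X_m$ is its value at $m+1$. For $m\geq 1$, let $\triangle(\mathbb X,m)$ be the object of $m$-cycles, i.e. of families $(x_j)_{0\le j\le m}$ in $\mathbb X_{m-1}$ with $\partial_jx_k=\partial_{k-1}x_j$ for $j<k$, and let $\Lambda^i(\mathbb X,m)$ be the object of $(m,i)$-horns, i.e. of such families with the index $i$ (and all conditions involving it) omitted; put $\triangle(\mathbb X,0)=\mathbb X_{-1}$. The object $\mathbb X$ is a *resolution* if $\langle\partial_i\rangle_i\colon\mathbb X_m\to\triangle(\mathbb X,m)$ is a regular epimorphism for all $m\ge 0$. A simplicial morphism $f\colon\mathbb X\to\mathbb Y$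 is a *fibration* if for all $m\ge 1$ and $0\le i\le m$ the comparison $\mathbb X_m\to\Lambda^i(\mathbb X,m)\times_{\Lambda^i(\mathbb Y,m)}\mathbb Y_m$ is a regular epimorphism; it is *exact from degree $n$ on* if this comparison is an isomorphism for all $m\ge n$, $m\geq 1$ and all $i$. *Torsors.* Let $\mathbb K(Z,A,n)$ be the coskeleton of the $(n+1)$-truncated augmented simplicial object which is $Z$ in degrees $-1,\dots,n-1$ (with identities as operators), $A\times Z$ in degree $n$ (with faces $\mathrm{pr}_Z$ and degeneracies $\langle 0,1_Z\rangle$), and $A^{n+1}\times Z$ in degree $n+1$, with faces $\partial_i=\mathrm{pr}_i\times 1_Z$ for $0\le i\le n$ and $\partial_{n+1}=\bigl((-1)^n\sum_{i=0}^n(-1)^i\mathrm{pr}_i\bigr)\times 1_Z$. An *$n$-torsor of $Z$ by $A$* is an augmented simplicial object $\mathbb T$ with a simplicial morphism $t\colon\mathbb T\to\mathbb K(Z,A,n)$ such that (T1) $t$ is a fibration which is exact from degree $n$ on; (T2) $\mathbb T$ is the $(n-1)$-coskeleton of its $(n-1)$-truncation; (T3) $\mathbb T$ is a resolution. Its underlying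 $n$-fold arrow is the functor $T\colon(2^n)^{\mathrm{op}}\to\mathcal X$ on the power set $2^n$ of $n=\{0,\dots,n-1\}$ with $T_I=\mathbb T_{|I|-1}$, which sends an inclusion $I\subseteq J$ to the operator $\mathbb T_{|J|-1}\to\mathbb T_{|I|-1}$ given by the corresponding order preserving map $|I|\to|J|$. *Extensions.* A $1$-cubic extension is a regular epimorphism; for $m\ge2$ an $m$-cubic extension is a commutative square of $(m-2)$-fold arrows $$\begin{array}{ccc}X&\xrightarrow{\,c\,}&C\\ {\scriptstyle d}\downarrow&&\downarrow{\scriptstyle g}\\ D&\xrightarrow{\,f\,}&Z'\end{array}$$ such that $c,d,f,g$ and the comparison $X\to D\times_{Z'}C$ are $(m-1)$-cubic extensions. For an $n$-fold arrow $F$, write $f_i\colon F_n\to F_{n\setminus\{i\}}$ for its initial arrows and $K[f_i]$ for their kernels. For $k\colon K\to X$ and $l\colon L\to X$, the Huq commutator $[K,L]$ is the kernel of $X\to Q$, where $Q$ is the colimit of the diagram formed by $k$, $l$, $\langle1,0\rangle\colon K\to K\times L$ and $\langle 0,1\rangle\colon L\to K\times L$. **Proposition.** For every $n$-torsor $(\mathbb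 T,t)$ of $Z$ by $A$, the underlying $n$-fold arrow $T$ of $\mathbb T$ is an H-central $n$-cubic extension; that is, $T$ is an $n$-cubic extension and, writing $f_i=\partial_i\colon\mathbb T_{n-1}\to\mathbb T_{n-2}$ for its initial arrows, $$\Bigl[\bigcap_{i\in I}K[f_i],\ \bigcap_{i\in n\setminus I}K[f_i]\Bigr]=0\qquad\text{for every } I\subseteq n=\{0,\dots,n-1\},$$ where the empty intersection is $T_n=\mathbb T_{n-1}$. -/

import Mathlib

open CategoryTheory CategoryTheory.Limits Opposite

universe v u

namespace HigherTorsors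

noncomputable section

/-! ### Semi-abelian categories -/

/-- A semi-abelian category: pointed, Barr-exact (regular, and every internal equivalence relation
is a kernel pair), Bourn-protomodular (the Split Short Five Lemma holds), with binary coproducts. -/
class SemiAbelian (C : Type u) [Category.{v} C] [HasZeroMorphisms C] : Prop
    extends Regular C, HasZeroObject C where
  hasBinaryCoproducts : HasBinaryCoproducts C
  exists_isKernelPair : ∀ {R X : C} (r₀ r₁ : R ⟶ X), IsEquivalenceRelation r₀ r₁ →
    ∃ (Y : C) (f : X ⟶ Y), IsKernelPair f r₀ r₁
  split_short_five : ∀ {X' Y' X Y : C} (f' : X' ⟶ Y') (s' : Y' ⟶ X') (f : X ⟶ Y) (s : Y ⟶ X)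
    (x : X' ⟶ X) (y : Y' ⟶ Y), s' ≫ f' = 𝟙 Y' → s ≫ f = 𝟙 Y → s' ≫ x = y ≫ s →
    ∀ w : f' ≫ y = x ≫ f, IsIso (kernel.map f' f x y w) → IsIso y → IsIso x

/-! ### The Huq commutator -/

section Huq

variable {C : Type u} [Category.{v} C] [HasZeroMorphisms C] [HasFiniteLimits C]

/-- The pair `(q, φ)`, with `q : X ⟶ Q` and `φ : K × L ⟶ Q`, is a colimit of the diagram formed by
`k : K ⟶ X`, `l : L ⟶ X`, `⟨1, 0⟩ : K ⟶ K × L` and `⟨0, 1⟩ : L ⟶ K × L`. -/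
structure IsHuqColimit {K L X Q : C} (k : K ⟶ X) (l : L ⟶ X) (q : X ⟶ Q) (φ : K ⨯ L ⟶ Q) :
    Prop where
  left : prod.lift (𝟙 K) 0 ≫ φ = k ≫ q
  right : prod.lift 0 (𝟙 L) ≫ φ = l ≫ q
  desc : ∀ {Q' : C} (q' : X ⟶ Q') (φ' : K ⨯ L ⟶ Q'),
    prod.lift (𝟙 K) 0 ≫ φ' = k ≫ q' → prod.lift 0 (𝟙 L) ≫ φ' = l ≫ q' →
    ∃! p : Q ⟶ Q', q ≫ p = q' ∧ φ ≫ p = φ'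

/-- The subobject `N` of `X` is the Huq commutator `[k, l]`, that is, the kernel of the morphism
`q : X ⟶ Q` to the colimit `Q` in `IsHuqColimit`. -/
def IsHuqCommutator {K L X : C} (k : K ⟶ X) (l : L ⟶ X) (N : Subobject X) : Prop :=
  ∃ (Q : C) (q : X ⟶ Q) (φ : K ⨯ L ⟶ Q), IsHuqColimit k l q φ ∧ N = kernelSubobject q

end Huq

/-! ### Higher arrows and higher cubic extensions -/

section Cubes

/-- The category of `n`-fold arrows in `C`: functors `(2ⁿ)ᵒᵖ ⥤ C`, where `2ⁿ` is the power set of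
`{0, …, n - 1}`, ordered by inclusion. -/
abbrev Cube (C : Type u) [Category.{v} C] (n : ℕ) := (Finset (Fin n))ᵒᵖ ⥤ C

/-- The inclusion of `2ⁿ` into `2ⁿ⁺¹` as the subsets not containing the last element. -/
def codIncl (n : ℕ) : Finset (Fin n) ⥤ Finset (Fin (n + 1)) :=
  Monotone.functor (f := fun I => I.map Fin.castSuccEmb)
    (fun _ _ h => Finset.map_subset_map.2 h)

/-- The inclusion of `2ⁿ` into `2ⁿ⁺¹` as the subsets containing the last element. -/
def domIncl (n : ℕ) : Finset (Fin n) ⥤ Finset (Fin (n + 1)) :=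
  Monotone.functor (f := fun I => insert (Fin.last n) (I.map Fin.castSuccEmb))
    (fun _ _ h => Finset.insert_subset_insert _ (Finset.map_subset_map.2 h))

/-- The inclusions `I ⊆ I ∪ {n}`. -/
def codToDom (n : ℕ) : codIncl n ⟶ domIncl n where
  app _ := homOfLE (Finset.subset_insert _ _)

variable (C : Type u) [Category.{v} C]

/-- The domain of an `(n + 1)`-fold arrow, when seen as an arrow between `n`-fold arrows. -/
def domFunctor (n : ℕ) : Cube C (n + 1) ⥤ Cube C n :=
  (Functor.whiskeringLeft _ _ C).obj (domIncl n).op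

/-- The codomain of an `(n + 1)`-fold arrow, when seen as an arrow between `n`-fold arrows. -/
def codFunctor (n : ℕ) : Cube C (n + 1) ⥤ Cube C n :=
  (Functor.whiskeringLeft _ _ C).obj (codIncl n).op

/-- An `(n + 1)`-fold arrow `F`, seen as an arrow `dom F ⟶ cod F` of `n`-fold arrows (natural
in `F`). -/
def arrowOf (n : ℕ) : domFunctor C n ⟶ codFunctor C n :=
  (Functor.whiskeringLeft _ _ C).map (NatTrans.op (codToDom n))

variable {C} [HasPullbacks C]

/-- An arrow `f : F ⟶ G` between `n`-fold arrows is an `(n + 1)`-cubic extension. For `n = 0` this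
means that it is a regular epimorphism. An arrow between `(n + 1)`-fold arrows is seen as a square
```
    dom F ----> dom G
      |           |
    cod F ----> cod G
```
of `n`-fold arrows, of which the four sides and the comparison `dom F ⟶ cod F ×_{cod G} dom G`
have to be `(n + 1)`-cubic extensions. -/
def IsCubicExtensionArrow : (n : ℕ) → {F G : Cube C n} → (F ⟶ G) → Prop
  | 0, _, _, f => IsRegularEpi (f.app (op ∅))
  | n + 1, F, G, f =>
    IsCubicExtensionArrow n ((arrowOf C n).app F) ∧
    IsCubicExtensionArrow n ((arrowOf C n).app G) ∧
    IsCubicExtensionArrow n ((domFunctor C n).map f) ∧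
    IsCubicExtensionArrow n ((codFunctor C n).map f) ∧
    IsCubicExtensionArrow n
      (pullback.lift (f := (codFunctor C n).map f) (g := (arrowOf C n).app G)
        ((arrowOf C n).app F) ((domFunctor C n).map f) ((arrowOf C n).naturality f).symm)

/-- `n`-cubic extensions: any object for `n = 0`, regular epimorphisms for `n = 1`, and suitable
commutative squares of `(n - 2)`-fold arrows for `n ≥ 2`. -/
def IsCubicExtension : (n : ℕ) → Cube C n → Prop
  | 0, _ => True
  | n + 1, F => IsCubicExtensionArrow n ((arrowOf C n).app F)

/-- The initial arrows `f_i : F_n ⟶ F_{n \ {i}}` of an `n`-fold arrow `F`. -/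
def initialArrow {n : ℕ} (F : Cube C n) (i : Fin n) :
    F.obj (op Finset.univ) ⟶ F.obj (op (Finset.univ.erase i)) :=
  F.map (homOfLE (Finset.erase_subset i Finset.univ)).op

/-- The intersection `⋂_{i ∈ I} K[f_i]`, as a subobject of `F_n` (all of `F_n` when `I = ∅`). -/
def kernelInter [HasZeroMorphisms C] [HasKernels C] {n : ℕ} (F : Cube C n) (I : Finset (Fin n)) :
    Subobject (F.obj (op Finset.univ)) :=
  I.inf fun i => kernelSubobject (initialArrow F i)

end Cubes

/-- An `n`-fold arrow is an H-central `n`-cubic extension when it is an `n`-cubic extension such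
that `[⋂_{i ∈ I} K[f_i], ⋂_{i ∉ I} K[f_i]] = 0` for all `I ⊆ {0, …, n - 1}`. -/
def IsHCentral {C : Type u} [Category.{v} C] [HasZeroMorphisms C] [SemiAbelian C] {n : ℕ}
    (F : Cube C n) : Prop :=
  IsCubicExtension n F ∧
    ∀ I : Finset (Fin n), IsHuqCommutator (kernelInter F I).arrow (kernelInter F Iᶜ).arrow ⊥

/-! ### Augmented simplicial objects -/

/-- The objects of the augmented simplicial category: the finite ordinals `{0, …, len - 1}`. -/
structure AugOrd : Type where
  /-- the number of elements -/
  len : ℕ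

/-- The morphisms of the augmented simplicial category are the order preserving functions. -/
instance : SmallCategory AugOrd where
  Hom a b := Fin a.len →o Fin b.len
  id _ := OrderHom.id
  comp f g := g.comp f

/-- An order preserving function, as a morphism of the augmented simplicial category. -/
def AugOrd.ofHom {m n : ℕ} (f : Fin m →o Fin n) : AugOrd.mk m ⟶ AugOrd.mk n := f

/-- The order preserving function underlying a morphism. -/
def AugOrd.toHom {a b : AugOrd} (f : a ⟶ b) : Fin a.len →o Fin b.len := f

/-- The category of augmented simplicial objects. The object in simplicial degree `n ≥ -1` is the
value at the ordinal with `n + 1` elements. -/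
abbrev AugSimplicial (C : Type u) [Category.{v} C] := AugOrdᵒᵖ ⥤ C

section Simplicial

variable {C : Type u} [Category.{v} C]

/-- The object of an augmented simplicial object in absolute degree `k`, which is simplicial degree
`k - 1`. -/
abbrev AugSimplicial.deg (X : AugSimplicial C) (k : ℕ) : C := X.obj (op ⟨k⟩)

/-- The face operator `∂_i : X_k ⟶ X_{k - 1}`, for `0 ≤ i ≤ k` (simplicial degrees). -/
def face (X : AugSimplicial C) {k : ℕ} (i : Fin (k + 1)) : X.deg (k + 1) ⟶ X.deg k :=
  X.map (AugOrd.ofHom (Fin.succAboveOrderEmb i).toOrderHom).op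

theorem face_naturality {X Y : AugSimplicial C} (f : X ⟶ Y) {k : ℕ} (i : Fin (k + 1)) :
    face X i ≫ f.app (op ⟨k⟩) = f.app (op ⟨k + 1⟩) ≫ face Y i :=
  f.naturality _

theorem face_comp_face (X : AugSimplicial C) {k : ℕ} {a b : Fin (k + 1)} (h : a ≤ b) :
    face X b.succ ≫ face X a = face X a.castSucc ≫ face X b := by
  unfold face
  rw [← X.map_comp, ← X.map_comp, ← op_comp, ← op_comp]
  congr 2
  apply OrderHom.ext
  funext x
  change b.succ.succAbove (a.succAbove x) = a.castSucc.succAbove (b.succAbove x)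
  ext
  simp only [Fin.succAbove, Fin.lt_def, Fin.le_def] at h ⊢
  split_ifs <;> simp_all <;> omega

variable [HasFiniteLimits C]

/-- The index set of the conditions which define `FaceFamilies`. -/
abbrev FacePairs (m : ℕ) (S : Finset (Fin (m + 2))) :=
  {p : Fin (m + 1) × Fin (m + 1) // p.1 ≤ p.2 ∧ p.1.castSucc ∈ S ∧ p.2.succ ∈ S}

/-- For `n = m + 1 ≥ 1` and `S ⊆ {0, …, n}`, the object of families `(x_j)_{j ∈ S}` in `X_{n - 1}`
(simplicial degree) such that `∂_j x_k = ∂_{k - 1} x_j` for all `j < k` in `S`. The conditions are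
indexed by the pairs `a ≤ b`, with `j = a` and `k = b + 1`. -/
def FaceFamilies (X : AugSimplicial C) (m : ℕ) (S : Finset (Fin (m + 2))) : C :=
  equalizer (X := ∏ᶜ fun _ : S => X.deg (m + 1)) (Y := ∏ᶜ fun _ : FacePairs m S => X.deg m)
    (Pi.lift fun p => Pi.π _ ⟨p.1.2.succ, p.2.2.2⟩ ≫ face X p.1.1)
    (Pi.lift fun p => Pi.π _ ⟨p.1.1.castSucc, p.2.2.1⟩ ≫ face X p.1.2)

/-- The projection which sends a family `(x_j)_{j ∈ S}` to `x_j`. -/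
def FaceFamilies.proj (X : AugSimplicial C) {m : ℕ} {S : Finset (Fin (m + 2))} (j : S) :
    FaceFamilies X m S ⟶ X.deg (m + 1) :=
  equalizer.ι _ _ ≫ Pi.π (fun _ : S => X.deg (m + 1)) j

theorem FaceFamilies.condition (X : AugSimplicial C) {m : ℕ} {S : Finset (Fin (m + 2))}
    (a b : Fin (m + 1)) (h : a ≤ b) (ha : a.castSucc ∈ S) (hb : b.succ ∈ S) :
    proj X ⟨b.succ, hb⟩ ≫ face X a = proj X ⟨a.castSucc, ha⟩ ≫ face X b := by
  have h' := congrArg (fun g => g ≫ Pi.π (fun _ : FacePairs m S => X.deg m) ⟨(a, b), h, ha, hb⟩)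
    (equalizer.condition
      (Pi.lift fun p : FacePairs m S => Pi.π (fun _ : S => X.deg (m + 1)) ⟨p.1.2.succ, p.2.2.2⟩ ≫
        face X p.1.1)
      (Pi.lift fun p : FacePairs m S => Pi.π (fun _ : S => X.deg (m + 1))
        ⟨p.1.1.castSucc, p.2.2.1⟩ ≫ face X p.1.2))
  simp only [Category.assoc, Pi.lift_π] at h'
  exact (Category.assoc _ _ _).trans (h'.trans (Category.assoc _ _ _).symm)

theorem FaceFamilies.hom_ext {X : AugSimplicial C} {m : ℕ} {S : Finset (Fin (m + 2))} {W : C}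
    {f g : W ⟶ FaceFamilies X m S} (h : ∀ j, f ≫ proj X j = g ≫ proj X j) : f = g := by
  apply equalizer.hom_ext
  apply Pi.hom_ext
  intro j
  exact (Category.assoc _ _ _).trans ((h j).trans (Category.assoc _ _ _).symm)

/-- The morphism to `FaceFamilies X m S` induced by a family of morphisms which satisfies the
conditions. -/
def FaceFamilies.lift {X : AugSimplicial C} {m : ℕ} {S : Finset (Fin (m + 2))} {W : C}
    (x : S → (W ⟶ X.deg (m + 1)))
    (hx : ∀ (a b : Fin (m + 1)) (_ : a ≤ b) (ha : a.castSucc ∈ S) (hb : b.succ ∈ S),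
      x ⟨b.succ, hb⟩ ≫ face X a = x ⟨a.castSucc, ha⟩ ≫ face X b) :
    W ⟶ FaceFamilies X m S :=
  equalizer.lift (Pi.lift x) (by
    apply Pi.hom_ext
    intro p
    simpa using hx p.1.1 p.1.2 p.2.1 p.2.2.1 p.2.2.2)

theorem FaceFamilies.lift_proj {X : AugSimplicial C} {m : ℕ} {S : Finset (Fin (m + 2))} {W : C}
    (x : S → (W ⟶ X.deg (m + 1)))
    (hx : ∀ (a b : Fin (m + 1)) (_ : a ≤ b) (ha : a.castSucc ∈ S) (hb : b.succ ∈ S),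
      x ⟨b.succ, hb⟩ ≫ face X a = x ⟨a.castSucc, ha⟩ ≫ face X b) (j : S) :
    lift x hx ≫ proj X j = x j := by
  have h : lift x hx ≫ equalizer.ι _ _ = Pi.lift x := equalizer.lift_ι _ _
  refine (Category.assoc _ _ _).symm.trans ?_
  rw [h]
  simp

/-- The morphism which sends a simplex of (simplicial) degree `m + 1` to the family of its faces
with index in `S`. -/
def toFaceFamilies (X : AugSimplicial C) (m : ℕ) (S : Finset (Fin (m + 2))) :
    X.deg (m + 2) ⟶ FaceFamilies X m S :=
  FaceFamilies.lift (fun j => face X j.1) fun _ _ h _ _ => face_comp_face X h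

/-- The morphism `(x_j)_j ↦ (f x_j)_j` induced by a simplicial morphism `f`. -/
def FaceFamilies.map {X Y : AugSimplicial C} (f : X ⟶ Y) (m : ℕ) (S : Finset (Fin (m + 2))) :
    FaceFamilies X m S ⟶ FaceFamilies Y m S :=
  FaceFamilies.lift (fun j => FaceFamilies.proj X j ≫ f.app (op ⟨m + 1⟩)) (by
    intro a b h ha hb
    rw [Category.assoc, Category.assoc, ← face_naturality, ← face_naturality,
      ← Category.assoc, ← Category.assoc, FaceFamilies.condition X a b h ha hb])

theorem toFaceFamilies_naturality {X Y : AugSimplicial C} (f : X ⟶ Y) (m : ℕ)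
    (S : Finset (Fin (m + 2))) :
    toFaceFamilies X m S ≫ FaceFamilies.map f m S =
      f.app (op ⟨m + 2⟩) ≫ toFaceFamilies Y m S := by
  apply FaceFamilies.hom_ext
  intro j
  rw [Category.assoc, Category.assoc, FaceFamilies.map, FaceFamilies.lift_proj, toFaceFamilies,
    toFaceFamilies, FaceFamilies.lift_proj, ← Category.assoc, FaceFamilies.lift_proj,
    face_naturality]

/-- The object `△(X, m + 1)` of `(m + 1)`-cycles: the simplicial kernel of the face operators
`X_m ⟶ X_{m - 1}`. -/
abbrev Cycles (X : AugSimplicial C) (m : ℕ) : C := FaceFamilies X m Finset.univ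

/-- The object of `(m + 1, i)`-horns. -/
abbrev Horns (X : AugSimplicial C) (m : ℕ) (i : Fin (m + 2)) : C :=
  FaceFamilies X m (Finset.univ.erase i)

/-- A resolution: for all `n ≥ 0` the comparison from `X_n` to the object `△(X, n)` of `n`-cycles is
a regular epimorphism, where `△(X, 0) = X_{-1}`. -/
structure IsResolution (X : AugSimplicial C) : Prop where
  zero : IsRegularEpi (face X (0 : Fin (0 + 1)))
  succ : ∀ m : ℕ, IsRegularEpi (toFaceFamilies X m Finset.univ)

/-- The comparison `X_n ⟶ Λⁱ(X, n) ×_{Λⁱ(Y, n)} Y_n`, in simplicial degree `n = m + 1 ≥ 1`. -/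
def kanComparison {X Y : AugSimplicial C} (f : X ⟶ Y) (m : ℕ) (i : Fin (m + 2)) :
    X.deg (m + 2) ⟶ pullback (FaceFamilies.map f m (Finset.univ.erase i))
      (toFaceFamilies Y m (Finset.univ.erase i)) :=
  pullback.lift (toFaceFamilies X m _) (f.app (op ⟨m + 2⟩)) (toFaceFamilies_naturality f m _)

/-- A fibration: the Kan condition holds in all simplicial degrees `n = m + 1 ≥ 1`. -/
def IsFibration {X Y : AugSimplicial C} (f : X ⟶ Y) : Prop :=
  ∀ (m : ℕ) (i : Fin (m + 2)), IsRegularEpi (kanComparison f m i)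

/-- The Kan condition holds exactly in all simplicial degrees `m + 1 ≥ n`. -/
def IsExactFrom (n : ℕ) {X Y : AugSimplicial C} (f : X ⟶ Y) : Prop :=
  ∀ (m : ℕ) (i : Fin (m + 2)), n ≤ m + 1 → IsIso (kanComparison f m i)

end Simplicial

/-! ### Truncations, coskeleta and underlying higher arrows -/

section Truncation

variable {C : Type u} [Category.{v} C]

/-- The full subcategory of the augmented simplicial category on the ordinals with at most `n`
elements. -/
abbrev TruncOrd (n : ℕ) := ObjectProperty.FullSubcategory fun a : AugOrd => a.len ≤ n

/-- The `(n - 1)`-truncation of an augmented simplicial object. -/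
def truncation (n : ℕ) (X : AugSimplicial C) : (TruncOrd n)ᵒᵖ ⥤ C :=
  (ObjectProperty.ι fun a : AugOrd => a.len ≤ n).op ⋙ X

/-- `X` is its own `(n - 1)`-coskeleton: it is the right Kan extension of its
`(n - 1)`-truncation. -/
def IsCoskeletal (n : ℕ) (X : AugSimplicial C) : Prop :=
  X.IsRightKanExtension (L := (ObjectProperty.ι fun a : AugOrd => a.len ≤ n).op)
    (F := truncation n X) (𝟙 (truncation n X))

/-- The functor `2ⁿ ⥤ Δ⁺` which maps a subset `I` to the ordinal `|I|`, and an inclusion `I ⊆ J` to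
the corresponding order preserving map `|I| ⟶ |J|`. -/
def cardFunctor (n : ℕ) : Finset (Fin n) ⥤ AugOrd where
  obj I := ⟨I.card⟩
  map {I J} h := AugOrd.ofHom
    { toFun := fun x => (J.orderIsoOfFin rfl).symm
        ⟨(I.orderIsoOfFin rfl x : Fin n), leOfHom h (I.orderIsoOfFin rfl x).2⟩
      monotone' := fun x y hxy => (J.orderIsoOfFin rfl).symm.monotone
        ((I.orderIsoOfFin rfl).monotone hxy) }
  map_id I := by
    apply OrderHom.ext
    funext x
    exact (I.orderIsoOfFin rfl).symm_apply_apply x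
  map_comp {I J K} f g := by
    apply OrderHom.ext
    funext x
    change (K.orderIsoOfFin rfl).symm _ = (K.orderIsoOfFin rfl).symm _
    congr 1
    apply Subtype.ext
    change _ = ((J.orderIsoOfFin rfl) ((J.orderIsoOfFin rfl).symm _) : Fin n)
    rw [OrderIso.apply_symm_apply]

/-- The `n`-fold arrow underlying (the `(n - 1)`-truncation of) an augmented simplicial object. -/
def underlyingCube (n : ℕ) (X : AugSimplicial C) : Cube C n := (cardFunctor n).op ⋙ X

end Truncation

/-! ### The simplicial objects `K(Z, A, n)` and torsors -/

section Torsors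

variable {C : Type u} [Category.{v} C] [CartesianMonoidalCategory C] [BraidedCategory C]

/-- The order preserving surjections from an ordinal to `{0, …, n}`. -/
abbrev SurjTo (n : ℕ) (a : AugOrd) := {s : Fin a.len →o Fin (n + 1) // Function.Surjective s}

instance (n : ℕ) (a : AugOrd) : Finite (SurjTo n a) :=
  Finite.of_injective (fun s => (s.1 : Fin a.len → Fin (n + 1)))
    fun _ _ h => Subtype.ext (OrderHom.ext _ _ h)

open scoped Classical in
instance (n : ℕ) (a : AugOrd) : Fintype (SurjTo n a) := Fintype.ofFinite _

open scoped Classical AddMonObj in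
/-- For `θ : a ⟶ b`, the morphism `A^{SurjTo n b} ⟶ A^{SurjTo n a}` which sends `x` to `y` where
`y_s` is the sum of all `x_r` with `r ∘ θ = s`. -/
def emPowMap (A : C) [AddGrpObj A] [IsCommAddMonObj A] (n : ℕ) {a b : AugOrd} (θ : a ⟶ b) :
    (∏ᶜ fun _ : SurjTo n b => A) ⟶ ∏ᶜ fun _ : SurjTo n a => A :=
  Pi.lift fun s => ∑ r with r.1.comp (AugOrd.toHom θ) = s.1, Pi.π (fun _ : SurjTo n b => A) r

open scoped Classical AddMonObj in
theorem emPowMap_id (A : C) [AddGrpObj A] [IsCommAddMonObj A] (n : ℕ) (a : AugOrd) :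
    emPowMap A n (𝟙 a) = 𝟙 _ := by
  apply Pi.hom_ext
  intro s
  have h : ∀ r : SurjTo n a, r.1.comp (AugOrd.toHom (𝟙 a)) = s.1 ↔ r = s :=
    fun r => Subtype.ext_iff.symm
  simp [emPowMap, h, Finset.filter_eq']

open scoped Classical AddMonObj in
theorem emPowMap_comp (A : C) [AddGrpObj A] [IsCommAddMonObj A] (n : ℕ) {a b c : AugOrd}
    (θ : a ⟶ b) (η : b ⟶ c) : emPowMap A n (θ ≫ η) = emPowMap A n η ≫ emPowMap A n θ := by
  apply Pi.hom_ext
  intro s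
  have hsum : ∀ {W W' : C} (g : W ⟶ W') (t : Finset (SurjTo n b)) (x : SurjTo n b → (W' ⟶ A)),
      g ≫ ∑ r ∈ t, x r = ∑ r ∈ t, g ≫ x r := fun g t x =>
    map_sum (AddMonoidHom.mk' (fun y : _ ⟶ A => g ≫ y) (AddMonObj.comp_add g)) x t
  simp only [emPowMap, Category.assoc, Pi.lift_π, hsum]
  rw [Finset.sum_sigma']
  symm
  refine Finset.sum_bij (fun r _ => r.2) ?_ ?_ ?_ (fun _ _ => rfl)
  · intro r hr
    simp only [Finset.mem_sigma, Finset.mem_filter, Finset.mem_univ, true_and] at hr ⊢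
    rw [← hr.1, ← hr.2]
    rfl
  · rintro ⟨r, q⟩ hr ⟨r', q'⟩ hr' h
    simp only [Finset.mem_sigma, Finset.mem_filter, Finset.mem_univ, true_and] at hr hr' h
    subst h
    obtain rfl : r = r' := Subtype.ext (hr.2.symm.trans hr'.2)
    rfl
  · intro q hq
    simp only [Finset.mem_filter, Finset.mem_univ, true_and] at hq
    refine ⟨⟨⟨q.1.comp (AugOrd.toHom η), ?_⟩, q⟩, ?_, rfl⟩
    · intro y
      obtain ⟨x, hx⟩ := s.2 y
      exact ⟨AugOrd.toHom θ x, (DFunLike.congr_fun hq x).trans hx⟩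
    · simp only [Finset.mem_sigma, Finset.mem_filter, Finset.mem_univ, true_and]
      exact ⟨hq, trivial⟩

/-- The augmented simplicial object `K(Z, A, n)` for an internal abelian group `A`: in simplicial
degree `m` it is `A^{S_m} × Z`, where `S_m` is the set of order preserving surjections
`{0, …, m} ⟶ {0, …, n}`.

Up to isomorphism this is `Z` below degree `n`, it is `A × Z` in degree `n`, and `A^{n + 1} × Z` in
degree `n + 1`, where the surjection `σ_j` hitting `j` twice contributes the coordinate `a_j`, and
`∂_i (a_0, …, a_n) = a_{i - 1} + a_i` (with `a_{-1} = a_{n + 1} = 0`). Hence `∂_0, …, ∂_n` are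
coordinates on `A^{n + 1}` in degree `n + 1`, in terms of which these faces are the projections
`pr_0, …, pr_n`, while `∂_{n + 1} = (-1)ⁿ ∑_{i ≤ n} (-1)ⁱ pr_i`. Since its normalised chain complex
is `A`, concentrated in degree `n`, it is the coskeleton of its `(n + 1)`-truncation. -/
def eilenbergMacLane (Z A : C) [AddGrpObj A] [IsCommAddMonObj A] (n : ℕ) : AugSimplicial C where
  obj a := (∏ᶜ fun _ : SurjTo n a.unop => A) ⨯ Z
  map θ := prod.map (emPowMap A n θ.unop) (𝟙 Z)
  map_id a := by
    rw [unop_id, emPowMap_id, prod.map_id_id]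
  map_comp θ η := by
    rw [unop_comp, emPowMap_comp, prod.map_map, Category.comp_id]

/-- An `n`-torsor of `Z` by the abelian object `A`: an augmented simplicial object with a morphism to
`K(Z, A, n)` which is a fibration, exact from degree `n` on, such that the object is a resolution
and is its own `(n - 1)`-coskeleton. -/
structure Torsor [HasFiniteLimits C] (Z A : C) [AddGrpObj A] [IsCommAddMonObj A] (n : ℕ) where
  /-- the augmented simplicial object -/
  obj : AugSimplicial C
  /-- the simplicial morphism to `K(Z, A, n)` -/
  hom : obj ⟶ eilenbergMacLane Z A n
  isFibration : IsFibration hom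
  isExactFrom : IsExactFrom n hom
  isCoskeletal : IsCoskeletal n obj
  isResolution : IsResolution obj

end Torsors

end

end HigherTorsors

/-!
The proof has two independent halves.

**Cubic extensions.** In a regular category a morphism is a regular epimorphism if and only if every
generalized element of its codomain lifts after a cover, that is, after precomposition with a
regular epimorphism. An `n`-fold arrow `F` is an `n`-cubic extension as soon as, for every `I`, each
compatible family of elements of the `F_J` with `J < I` comes locally from an element of `F_I`
(`HasLocalFillers`). To prove this by induction on `n`, morphisms of `n`-fold arrows are treated at
the same time, with a relative filling condition (`HasRelativeLocalFillers`): this is the argument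
for Reedy fibrations, with regular epimorphisms as fibrations. All morphisms which occur in the
definition of a cubic extension inherit the filling conditions, because a compatible family
below `I ∪ {n}` is a compatible family of the domain below `I` together with an element of the
codomain at `I` (`BoundaryFamily.exists_glue`). The `n`-fold arrow underlying a resolution has local
fillers since a family below `I` amounts to an `(|I| - 1)`-cycle (`IsResolution.exists_filler`).

**Commutators.** The Huq commutator of `k : K ⟶ X` and `l : L ⟶ X` is zero when `k` and `l`
cooperate, that is, when they extend to a morphism `K × L ⟶ X`; here `K` and `L` are jointly epic in
`K × L` by protomodularity (`prod_hom_ext_of_lift`). Let `T` be an `n`-torsor of `Z` by `A`. By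
exactness in degree `n`, the object `T_n` is the pullback of the object of `(n, i)`-horns in `T` and
of `A × Z` over the object of `(n, i)`-horns in `K(Z, A, n)`. Any two morphisms to the abelian
object `A` cooperate. So two morphisms to `T_n` cooperate as soon as their components in `Z` and
their faces with index different from `i` do, and then so do their `i`-th faces (`Torsor.cooperates_face`). Now
let `x` have zero faces `∂_i x` for `i ∈ I`, and let `y` have zero faces `∂_i y` for `i ∉ I`.
* If `j ∉ I` and `j + 1 ∈ I`, then for each index different from `j + 1` the face of `s_j x` or the
  face of `s_{j + 1} y` vanishes, while the faces with index `j + 1` are `x` and `y`.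
* If `I` is empty, then `(y, 0, …, 0)` is a cycle. As `T` is a resolution, it comes locally from an
  `n`-simplex, and this is compared with `s_0 x`. Cooperation descends along regular epimorphisms
  (`Cooperates.of_regularEpi`).

The remaining cases follow by symmetry.
-/

namespace HigherTorsors

noncomputable section

attribute [local simp] prod.lift_fst prod.lift_snd prod.lift_fst_assoc prod.lift_snd_assoc
  pullback.lift_fst pullback.lift_snd

/-! ### Regular epimorphisms as local surjections -/

section Regular

variable {C : Type u} [Category.{v} C] [Regular C]

theorem isRegularEpi_of_comp {X Y W : C} (x : X ⟶ Y) (f : Y ⟶ W) (h : IsRegularEpi (x ≫ f)) :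
    IsRegularEpi f := by
  have : StrongEpi f := strongEpi_of_strongEpi x f
  infer_instance

theorem isRegularEpi_comp {X Y W : C} (f : X ⟶ Y) (g : Y ⟶ W) (hf : IsRegularEpi f)
    (hg : IsRegularEpi g) : IsRegularEpi (f ≫ g) := by
  have : StrongEpi (f ≫ g) := strongEpi_comp f g
  infer_instance

theorem exists_lift_of_isRegularEpi {X Y W : C} {f : X ⟶ Y} (hf : IsRegularEpi f) (y : W ⟶ Y) :
    ∃ (W' : C) (p : W' ⟶ W) (x : W' ⟶ X), IsRegularEpi p ∧ x ≫ f = p ≫ y :=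
  ⟨pullback f y, pullback.snd f y, pullback.fst f y, inferInstance, pullback.condition⟩

theorem isRegularEpi_of_exists_lift {X Y : C} {f : X ⟶ Y}
    (h : ∃ (W' : C) (p : W' ⟶ Y) (x : W' ⟶ X), IsRegularEpi p ∧ x ≫ f = p) :
    IsRegularEpi f := by
  obtain ⟨W', p, x, hp, hx⟩ := h
  exact isRegularEpi_of_comp x f (hx ▸ hp)

end Regular

/-! ### Cooperating morphisms -/

section Cooperates

variable {C : Type u} [Category.{v} C] [HasZeroMorphisms C] [HasFiniteLimits C]

/-- Two morphisms `k : K ⟶ X` and `l : L ⟶ X` cooperate if some morphism `K × L ⟶ X` restricts to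
`k` along `⟨1, 0⟩` and to `l` along `⟨0, 1⟩`. -/
def Cooperates {K L X : C} (k : K ⟶ X) (l : L ⟶ X) : Prop :=
  ∃ φ : K ⨯ L ⟶ X, prod.lift (𝟙 K) 0 ≫ φ = k ∧ prod.lift 0 (𝟙 L) ≫ φ = l

namespace Cooperates

variable {K L X : C} {k : K ⟶ X} {l : L ⟶ X}

theorem symm (h : Cooperates k l) : Cooperates l k := by
  obtain ⟨φ, h₁, h₂⟩ := h
  refine ⟨prod.lift prod.snd prod.fst ≫ φ, ?_, ?_⟩
  · rw [← h₂, ← Category.assoc, prod.comp_lift, prod.lift_fst, prod.lift_snd]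
  · rw [← h₁, ← Category.assoc, prod.comp_lift, prod.lift_fst, prod.lift_snd]

theorem comp (h : Cooperates k l) {Y : C} (f : X ⟶ Y) : Cooperates (k ≫ f) (l ≫ f) := by
  obtain ⟨φ, h₁, h₂⟩ := h
  exact ⟨φ ≫ f, by rw [← h₁, Category.assoc], by rw [← h₂, Category.assoc]⟩

theorem zero_left (l : L ⟶ X) : Cooperates (0 : K ⟶ X) l :=
  ⟨prod.snd ≫ l, by simp, by simp⟩

theorem zero_right (k : K ⟶ X) : Cooperates k (0 : L ⟶ X) :=
  ⟨prod.fst ≫ k, by simp, by simp⟩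

theorem of_prod {Y Y' : C} {k : K ⟶ Y ⨯ Y'} {l : L ⟶ Y ⨯ Y'}
    (h : Cooperates (k ≫ prod.fst) (l ≫ prod.fst)) (h' : Cooperates (k ≫ prod.snd) (l ≫ prod.snd)) :
    Cooperates k l := by
  obtain ⟨φ, h₁, h₂⟩ := h
  obtain ⟨ψ, h₃, h₄⟩ := h'
  exact ⟨prod.lift φ ψ, by ext <;> simp [h₁, h₃], by ext <;> simp [h₂, h₄]⟩

theorem of_pi {ι : Type*} [Finite ι] {Y : ι → C} {k : K ⟶ ∏ᶜ Y} {l : L ⟶ ∏ᶜ Y}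
    (h : ∀ i, Cooperates (k ≫ Pi.π Y i) (l ≫ Pi.π Y i)) : Cooperates k l := by
  choose φ h₁ h₂ using h
  refine ⟨Pi.lift φ, Pi.hom_ext _ _ fun i => ?_, Pi.hom_ext _ _ fun i => ?_⟩
  · rw [Category.assoc, Pi.lift_π, h₁]
  · rw [Category.assoc, Pi.lift_π, h₂]

/-- Any two morphisms into an internal (abelian) monoid cooperate: their sum is a cooperator. -/
theorem of_addMonObj [CartesianMonoidalCategory C] {A : C} [AddMonObj A] (k : K ⟶ A) (l : L ⟶ A) :
    Cooperates k l := by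
  -- the neutral element is the zero morphism, since it factors through the terminal object
  have zero : ∀ W : C, (0 : W ⟶ A) =
      (0 : W ⟶ MonoidalCategoryStruct.tensorUnit C) ≫ AddMonObj.zero := fun _ => zero_comp.symm
  refine ⟨CartesianMonoidalCategory.lift (prod.fst ≫ k) (prod.snd ≫ l) ≫ AddMonObj.add, ?_, ?_⟩
  · rw [CartesianMonoidalCategory.comp_lift_assoc, prod.lift_fst_assoc, prod.lift_snd_assoc,
      zero_comp, Category.id_comp, zero, AddMonObj.lift_comp_zero_right]
  · rw [CartesianMonoidalCategory.comp_lift_assoc, prod.lift_fst_assoc, prod.lift_snd_assoc,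
      zero_comp, Category.id_comp, zero, AddMonObj.lift_comp_zero_left]

end Cooperates

end Cooperates

section JointlyEpic

variable {C : Type u} [Category.{v} C] [HasZeroMorphisms C] [SemiAbelian C]

/-- A semi-abelian category is unital: the equalizer of two morphisms out of `K × L` which agree on
`K` and on `L` is everything, by the Split Short Five Lemma applied to the projections to `L`. -/
theorem prod_hom_ext_of_lift {K L W : C} {f g : K ⨯ L ⟶ W}
    (h₁ : prod.lift (𝟙 K) 0 ≫ f = prod.lift (𝟙 K) 0 ≫ g)
    (h₂ : prod.lift 0 (𝟙 L) ≫ f = prod.lift 0 (𝟙 L) ≫ g) : f = g := by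
  have hκ : kernel.ι (prod.snd : K ⨯ L ⟶ L) =
      (kernel.ι (prod.snd : K ⨯ L ⟶ L) ≫ prod.fst) ≫ prod.lift (𝟙 K) 0 := by
    ext <;> simp
  have hiso : IsIso (equalizer.ι f g) := by
    refine SemiAbelian.split_short_five (equalizer.ι f g ≫ prod.snd)
      (equalizer.lift (prod.lift 0 (𝟙 L)) h₂) (prod.snd : K ⨯ L ⟶ L) (prod.lift 0 (𝟙 L))
      (equalizer.ι f g) (𝟙 L) (by simp) (by simp) (by simp) (by simp) ?_ inferInstance
    refine ⟨kernel.lift _ ((kernel.ι (prod.snd : K ⨯ L ⟶ L) ≫ prod.fst) ≫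
      equalizer.lift (prod.lift (𝟙 K) 0) h₁) (by simp), ?_, ?_⟩
    · rw [← cancel_mono (kernel.ι _), ← cancel_mono (equalizer.ι f g)]
      simp only [Category.assoc, kernel.lift_ι, equalizer.lift_ι, Category.id_comp]
      ext <;> simp
    · rw [← cancel_mono (kernel.ι _)]
      simp only [kernel.map, Category.assoc, kernel.lift_ι, kernel.lift_ι_assoc, equalizer.lift_ι,
        Category.id_comp]
      exact (Category.assoc _ _ _).symm.trans hκ.symm
  rw [← cancel_epi (equalizer.ι f g), equalizer.condition]

/-- A cooperator of `k` and `p ≫ l` factors through the regular epimorphism `1 × p`, since it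
coequalizes the kernel pair of `1 × p`, as can be tested on the two factors of `K × R`, where `R` is
the kernel pair of `p`. -/
theorem Cooperates.of_regularEpi {K L L' X : C} {k : K ⟶ X} {l : L ⟶ X} (p : L' ⟶ L)
    (hp : IsRegularEpi p) (h : Cooperates k (p ≫ l)) : Cooperates k l := by
  obtain ⟨φ, h₁, h₂⟩ := h
  have hreg : IsRegularEpi (prod.map (𝟙 K) p) :=
    isRegularEpi_of_exists_lift ⟨pullback p (prod.snd : K ⨯ L ⟶ L), pullback.snd _ _,
      prod.lift (pullback.snd _ _ ≫ prod.fst) (pullback.fst _ _), inferInstance, by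
        ext <;> simp [pullback.condition]⟩
  have hφ : ∀ {Z : C} (a b : Z ⟶ K ⨯ L'), a ≫ prod.map (𝟙 K) p = b ≫ prod.map (𝟙 K) p →
      a ≫ φ = b ≫ φ := by
    intro Z a b hab
    have hfst : a ≫ prod.fst = b ≫ prod.fst := by
      simpa using congrArg (· ≫ prod.fst) hab
    have hsnd : (a ≫ prod.snd) ≫ p = (b ≫ prod.snd) ≫ p := by
      simpa using congrArg (· ≫ prod.snd) hab
    have key : prod.map (𝟙 K) (pullback.fst p p) ≫ φ = prod.map (𝟙 K) (pullback.snd p p) ≫ φ := by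
      apply prod_hom_ext_of_lift
      · simp only [← Category.assoc, prod.lift_map, Category.comp_id, zero_comp]
      · have : ∀ q : pullback p p ⟶ L', prod.lift 0 (𝟙 _) ≫ prod.map (𝟙 K) q ≫ φ = q ≫ p ≫ l := by
          intro q
          rw [← h₂, ← Category.assoc, ← Category.assoc]
          congr 1
          ext <;> simp
        rw [this, this, pullback.condition_assoc]
    have ha : a = prod.lift (a ≫ prod.fst) (pullback.lift _ _ hsnd) ≫
        prod.map (𝟙 K) (pullback.fst p p) := by ext <;> simp
    have hb : b = prod.lift (a ≫ prod.fst) (pullback.lift _ _ hsnd) ≫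
        prod.map (𝟙 K) (pullback.snd p p) := by ext <;> simp [hfst]
    rw [ha, Category.assoc, key, ← Category.assoc, ← hb]
  refine ⟨IsRegularEpi.desc _ φ (hφ _ _ (IsRegularEpi.w _)), ?_, ?_⟩
  · have : prod.lift (𝟙 K) (0 : K ⟶ L) = prod.lift (𝟙 K) 0 ≫ prod.map (𝟙 K) p := by simp
    rw [this, Category.assoc, IsRegularEpi.fac, h₁]
  · have : p ≫ prod.lift (0 : L ⟶ K) (𝟙 L) = prod.lift 0 (𝟙 L') ≫ prod.map (𝟙 K) p := by
      ext <;> simp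
    rw [← cancel_epi p, ← h₂, ← Category.assoc, this, Category.assoc, IsRegularEpi.fac]

/-- If `k` and `l` cooperate, then the colimit defining their Huq commutator is the codomain
of `k` and `l` itself. -/
theorem Cooperates.isHuqCommutator_bot {K L X : C} {k : K ⟶ X} {l : L ⟶ X}
    (h : Cooperates k l) : IsHuqCommutator k l ⊥ := by
  obtain ⟨φ, h₁, h₂⟩ := h
  refine ⟨X, 𝟙 X, φ, ⟨by simp [h₁], by simp [h₂], ?_⟩, ?_⟩
  · intro Q' q' φ' h₁' h₂'
    refine ⟨q', ⟨Category.id_comp _, prod_hom_ext_of_lift ?_ ?_⟩, fun p hp => by simpa using hp.1⟩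
    · rw [← Category.assoc, h₁, h₁']
    · rw [← Category.assoc, h₂, h₂']
  · exact ((Subobject.mk_eq_bot_iff_zero).2 (kernel.ι_of_mono (𝟙 X))).symm

end JointlyEpic

/-! ### Degeneracies and vanishing faces -/

section Degeneracy

theorem exists_comp_eq_of_forall_ne {a b : ℕ} (θ : Fin a →o Fin (b + 1)) (p : Fin (b + 1))
    (h : ∀ x, θ x ≠ p) :
    ∃ θ' : Fin a →o Fin b, (Fin.succAboveOrderEmb p).toOrderHom.comp θ' = θ := by
  choose θ' hθ' using fun x => Fin.exists_succAbove_eq (h x)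
  refine ⟨⟨θ', fun x y hxy => ?_⟩, OrderHom.ext _ _ (funext hθ')⟩
  rw [← Fin.succAbove_le_succAbove_iff (p := p), hθ', hθ']
  exact θ.monotone hxy

theorem val_succAbove {n : ℕ} (i : Fin (n + 1)) (x : Fin n) :
    (i.succAbove x : ℕ) = if (x : ℕ) < i then (x : ℕ) else x + 1 := by
  rw [Fin.succAbove]
  split_ifs with h h' h' <;> rw [Fin.lt_def, Fin.val_castSucc] at h <;>
    simp only [Fin.val_castSucc, Fin.val_succ] <;> omega

theorem val_predAbove {n : ℕ} (j : Fin n) (x : Fin (n + 1)) :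
    (j.predAbove x : ℕ) = if (j : ℕ) < x then (x : ℕ) - 1 else x := by
  rw [Fin.predAbove]
  split_ifs with h h' h' <;> rw [Fin.lt_def, Fin.val_castSucc] at h <;>
    simp only [Fin.val_pred, Fin.coe_castPred] <;> omega

variable {C : Type u} [Category.{v} C]

theorem map_ofHom_comp (X : AugSimplicial C) {a b c : ℕ} (θ : Fin a →o Fin b) (η : Fin b →o Fin c) :
    X.map (AugOrd.ofHom (η.comp θ)).op = X.map (AugOrd.ofHom η).op ≫ X.map (AugOrd.ofHom θ).op :=
  X.map_comp (AugOrd.ofHom η).op (AugOrd.ofHom θ).op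

/-- The degeneracy operator `X_k ⟶ X_{k + 1}` (simplicial degrees) induced by the order preserving
surjection which hits `j` twice. -/
def degeneracy (X : AugSimplicial C) {k : ℕ} (j : Fin (k + 1)) : X.deg (k + 1) ⟶ X.deg (k + 2) :=
  X.map (AugOrd.ofHom (Fin.predAboveOrderHom j)).op

theorem degeneracy_face (X : AugSimplicial C) {k : ℕ} (j : Fin (k + 1)) (i : Fin (k + 2)) :
    degeneracy X j ≫ face X i = X.map (AugOrd.ofHom
      ((Fin.predAboveOrderHom j).comp (Fin.succAboveOrderEmb i).toOrderHom)).op :=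
  (map_ofHom_comp X _ _).symm

theorem degeneracy_face_eq_id (X : AugSimplicial C) {k : ℕ} (j : Fin (k + 1)) (i : Fin (k + 2))
    (hi : i = j.castSucc ∨ i = j.succ) : degeneracy X j ≫ face X i = 𝟙 _ := by
  rw [degeneracy_face, ← X.map_id]
  congr 2
  apply OrderHom.ext
  funext x
  change j.predAbove (i.succAbove x) = x
  rw [Fin.ext_iff, val_predAbove, val_succAbove]
  rcases hi with rfl | rfl <;> simp only [Fin.val_castSucc, Fin.val_succ] <;> split_ifs <;> omega

variable [HasZeroMorphisms C]

theorem comp_map_eq_zero {X : AugSimplicial C} {K : C} {a b : ℕ} {k : K ⟶ X.deg (b + 1)}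
    {p : Fin (b + 1)} (hk : k ≫ face X p = 0) (θ : Fin a →o Fin (b + 1)) (h : ∀ x, θ x ≠ p) :
    k ≫ X.map (AugOrd.ofHom θ).op = 0 := by
  obtain ⟨θ', rfl⟩ := exists_comp_eq_of_forall_ne θ p h
  rw [map_ofHom_comp, ← Category.assoc]
  exact (congrArg (· ≫ _) hk).trans zero_comp

/-- If `p ≠ j`, then exactly one element is sent to `p` by the surjection which hits `j` twice.
Omitting it gives a face of the `j`-th degeneracy which factors through the face `∂_p`. -/
theorem comp_degeneracy_face_eq_zero_of_lt {X : AugSimplicial C} {K : C} {b : ℕ}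
    {k : K ⟶ X.deg (b + 1)} {p j : Fin (b + 1)} (hk : k ≫ face X p = 0) (h : p < j) :
    (k ≫ degeneracy X j) ≫ face X p.castSucc = 0 := by
  rw [Category.assoc, degeneracy_face]
  refine comp_map_eq_zero hk _ fun x => ?_
  change j.predAbove (p.castSucc.succAbove x) ≠ p
  intro hx
  rw [Fin.ext_iff, val_predAbove, val_succAbove] at hx
  simp only [Fin.val_castSucc, Fin.lt_def] at hx h
  split_ifs at hx <;> omega

theorem comp_degeneracy_face_eq_zero_of_gt {X : AugSimplicial C} {K : C} {b : ℕ}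
    {k : K ⟶ X.deg (b + 1)} {p j : Fin (b + 1)} (hk : k ≫ face X p = 0) (h : j < p) :
    (k ≫ degeneracy X j) ≫ face X p.succ = 0 := by
  rw [Category.assoc, degeneracy_face]
  refine comp_map_eq_zero hk _ fun x => ?_
  change j.predAbove (p.succ.succAbove x) ≠ p
  intro hx
  rw [Fin.ext_iff, val_predAbove, val_succAbove] at hx
  simp only [Fin.val_succ, Fin.lt_def] at hx h
  split_ifs at hx <;> omega

end Degeneracy

/-! ### Cooperation of faces -/

section EilenbergMacLane

variable {C : Type u} [Category.{v} C] [CartesianMonoidalCategory C] [BraidedCategory C]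
  {Z A : C} [AddGrpObj A] [IsCommAddMonObj A] {n : ℕ}

/-- The projection of `K(Z, A, n)` to the constant simplicial object `Z`. -/
def eilenbergMacLaneToBase (Z A : C) [AddGrpObj A] [IsCommAddMonObj A] (n : ℕ) (a : AugOrdᵒᵖ) :
    (eilenbergMacLane Z A n).obj a ⟶ Z :=
  (prod.snd : (∏ᶜ fun _ : SurjTo n a.unop => A) ⨯ Z ⟶ Z)

theorem eilenbergMacLane_map_toBase {a b : AugOrdᵒᵖ} (θ : a ⟶ b) :
    (eilenbergMacLane Z A n).map θ ≫ eilenbergMacLaneToBase Z A n b =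
      eilenbergMacLaneToBase Z A n a :=
  (prod.map_snd _ _).trans (Category.comp_id _)

end EilenbergMacLane

section Horn

variable {C : Type u} [Category.{v} C] [HasZeroMorphisms C] [SemiAbelian C]

/-- If the comparison to the object of `i`-horns over `f` is an isomorphism, then morphisms to
`X_{m + 1}` cooperate as soon as all their faces but the `i`-th and their composites with `f` do.
The cooperators of the faces form a horn, because the horn conditions can be tested on `K` and
`L`. -/
theorem Cooperates.of_isIso_kanComparison {X Y : AugSimplicial C} (f : X ⟶ Y) {m : ℕ}
    (i : Fin (m + 2)) [IsIso (kanComparison f m i)] {K L : C} {k : K ⟶ X.deg (m + 2)}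
    {l : L ⟶ X.deg (m + 2)}
    (hface : ∀ j, j ≠ i → Cooperates (k ≫ face X j) (l ≫ face X j))
    (hf : Cooperates (k ≫ f.app (op ⟨m + 2⟩)) (l ≫ f.app (op ⟨m + 2⟩))) : Cooperates k l := by
  choose e he₁ he₂ using hface
  obtain ⟨g, hg₁, hg₂⟩ := hf
  let ψ : K ⨯ L ⟶ Horns X m i := FaceFamilies.lift
    (fun j => e j.1 (Finset.ne_of_mem_erase j.2)) (by
      intro a b hab ha hb
      apply prod_hom_ext_of_lift
      · simp only [← Category.assoc, he₁]
        simp only [Category.assoc, face_comp_face X hab]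
      · simp only [← Category.assoc, he₂]
        simp only [Category.assoc, face_comp_face X hab])
  have hψ : ∀ j, ψ ≫ FaceFamilies.proj X j = e j.1 (Finset.ne_of_mem_erase j.2) :=
    FaceFamilies.lift_proj _ _
  have hψ₁ : prod.lift (𝟙 K) 0 ≫ ψ = k ≫ toFaceFamilies X m _ := by
    apply FaceFamilies.hom_ext
    intro j
    rw [Category.assoc, hψ, he₁, Category.assoc, toFaceFamilies, FaceFamilies.lift_proj]
  have hψ₂ : prod.lift 0 (𝟙 L) ≫ ψ = l ≫ toFaceFamilies X m _ := by
    apply FaceFamilies.hom_ext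
    intro j
    rw [Category.assoc, hψ, he₂, Category.assoc, toFaceFamilies, FaceFamilies.lift_proj]
  have hψg : ψ ≫ FaceFamilies.map f m _ = g ≫ toFaceFamilies Y m _ := by
    apply prod_hom_ext_of_lift
    · rw [← Category.assoc, hψ₁, ← Category.assoc, hg₁, Category.assoc, Category.assoc,
        toFaceFamilies_naturality]
    · rw [← Category.assoc, hψ₂, ← Category.assoc, hg₂, Category.assoc, Category.assoc,
        toFaceFamilies_naturality]
  refine ⟨pullback.lift ψ g hψg ≫ inv (kanComparison f m i), ?_, ?_⟩
  · rw [← Category.assoc, IsIso.comp_inv_eq]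
    apply pullback.hom_ext
    · simp [kanComparison, hψ₁]
    · simp [kanComparison, hg₁]
  · rw [← Category.assoc, IsIso.comp_inv_eq]
    apply pullback.hom_ext
    · simp [kanComparison, hψ₂]
    · simp [kanComparison, hg₂]

variable [CartesianMonoidalCategory C] [BraidedCategory C]

section EilenbergMacLane

variable {Z A : C} [AddGrpObj A] [IsCommAddMonObj A] {n : ℕ}

/-- Since the components in powers of `A` always cooperate, only the component in `Z` matters. -/
theorem Cooperates.of_comp_toBase {a : AugOrdᵒᵖ} {K L : C} {k : K ⟶ (eilenbergMacLane Z A n).obj a}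
    {l : L ⟶ (eilenbergMacLane Z A n).obj a}
    (h : Cooperates (k ≫ eilenbergMacLaneToBase Z A n a) (l ≫ eilenbergMacLaneToBase Z A n a)) :
    Cooperates k l :=
  Cooperates.of_prod (Cooperates.of_pi fun _ => Cooperates.of_addMonObj _ _) h

/-- The projection of a torsor to the constant simplicial object `Z`. -/
def Torsor.toBase (T : Torsor Z A n) (a : AugOrdᵒᵖ) : T.obj.obj a ⟶ Z :=
  T.hom.app a ≫ eilenbergMacLaneToBase Z A n a

theorem Torsor.map_toBase (T : Torsor Z A n) {a b : AugOrdᵒᵖ} (θ : a ⟶ b) :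
    T.obj.map θ ≫ T.toBase b = T.toBase a := by
  rw [toBase, ← Category.assoc, T.hom.naturality, Category.assoc, eilenbergMacLane_map_toBase,
    toBase]

end EilenbergMacLane

section Torsor

variable {Z A : C} [AddGrpObj A] [IsCommAddMonObj A] {m : ℕ} (T : Torsor Z A (m + 1)) {K L : C}

theorem Torsor.comp_toBase_eq_zero {k : K ⟶ T.obj.deg (m + 1)} {i : Fin (m + 1)}
    (h : k ≫ face T.obj i = 0) : k ≫ T.toBase _ = 0 := by
  rw [← T.map_toBase (AugOrd.ofHom (Fin.succAboveOrderEmb i).toOrderHom).op, ← Category.assoc]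
  exact (congrArg (· ≫ _) h).trans zero_comp

/-- Exactness in degree `n = m + 1`: an `n`-simplex of `T` is determined by any of its horns and by
its image in `A × Z`, and all combinations over the same horn in `Z` occur. Since any two morphisms
into the abelian object `A` cooperate, no condition on the components in `A` is needed. -/
theorem Torsor.cooperates_face {k : K ⟶ T.obj.deg (m + 2)} {l : L ⟶ T.obj.deg (m + 2)}
    (i : Fin (m + 2))
    (hface : ∀ j, j ≠ i → Cooperates (k ≫ face T.obj j) (l ≫ face T.obj j))
    (hbase : Cooperates (k ≫ T.toBase _) (l ≫ T.toBase _)) :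
    Cooperates (k ≫ face T.obj i) (l ≫ face T.obj i) := by
  have := T.isExactFrom m i le_rfl
  refine (Cooperates.of_isIso_kanComparison T.hom i hface
    (Cooperates.of_comp_toBase ?_)).comp _
  rw [Category.assoc, Category.assoc]
  exact hbase

/-- If `j ∉ I` and `j + 1 ∈ I`, then the faces of `s_j x` and of `s_{j + 1} y` with an index
different from `j + 1` cooperate, because one of them is zero; their faces with index `j + 1`
are `x` and `y`. -/
theorem Torsor.cooperates_of_notMem_of_mem (I : Finset (Fin (m + 1)))
    {k : K ⟶ T.obj.deg (m + 1)} {l : L ⟶ T.obj.deg (m + 1)}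
    (hk : ∀ i ∈ I, k ≫ face T.obj i = 0) (hl : ∀ i ∉ I, l ≫ face T.obj i = 0)
    (j : Fin m) (hj : j.castSucc ∉ I) (hj' : j.succ ∈ I) : Cooperates k l := by
  have hlast := T.cooperates_face (k := k ≫ degeneracy T.obj j.castSucc)
    (l := l ≫ degeneracy T.obj j.succ) j.succ.castSucc ?_ ?_
  · rwa [Category.assoc, Category.assoc,
      degeneracy_face_eq_id _ _ _ (.inr (Fin.succ_castSucc j).symm),
      degeneracy_face_eq_id _ _ _ (.inl rfl), Category.comp_id, Category.comp_id] at hlast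
  · intro i hi
    rcases lt_or_gt_of_ne hi with h | h
    · obtain ⟨p, rfl⟩ := Fin.exists_castSucc_eq.2 (Fin.ne_last_of_lt h)
      rw [Fin.castSucc_lt_castSucc_iff] at h
      by_cases hp : p ∈ I
      · rw [comp_degeneracy_face_eq_zero_of_lt (hk p hp)]
        · exact .zero_left _
        · refine lt_of_le_of_ne (Fin.le_castSucc_iff.2 h) ?_
          rintro rfl
          exact hj hp
      · rw [comp_degeneracy_face_eq_zero_of_lt (hl p hp) h]
        exact .zero_right _
    · obtain ⟨p, rfl⟩ := Fin.exists_succ_eq.2 (Fin.ne_zero_of_lt h)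
      have h' : j.succ ≤ p := by simpa [Fin.le_def, Fin.lt_def, Nat.lt_succ_iff] using h
      by_cases hp : p ∈ I
      · rw [comp_degeneracy_face_eq_zero_of_gt (hk p hp)]
        · exact .zero_left _
        · exact lt_of_lt_of_le (Fin.castSucc_lt_succ) h'
      · rw [comp_degeneracy_face_eq_zero_of_gt (hl p hp)]
        · exact .zero_right _
        · refine lt_of_le_of_ne h' ?_
          rintro rfl
          exact hp hj'
  · rw [degeneracy, Category.assoc k, T.map_toBase, T.comp_toBase_eq_zero (hk _ hj')]
    exact .zero_left _

/-- A morphism `l` of which all faces are zero fits, locally, into an `n`-simplex with faces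
`l, 0, …, 0`; this cooperates with `s_0 k` for every `k`. -/
theorem Torsor.cooperates_of_forall_face_eq_zero (k : K ⟶ T.obj.deg (m + 1))
    {l : L ⟶ T.obj.deg (m + 1)} (hl : ∀ i, l ≫ face T.obj i = 0) : Cooperates k l := by
  let c : L ⟶ Cycles T.obj m := FaceFamilies.lift (fun j => if j.1 = 0 then l else 0) (by
    intro a b _ _ _
    dsimp only
    split_ifs <;> simp [hl])
  obtain ⟨L', p, l', hp, hl'⟩ := exists_lift_of_isRegularEpi (T.isResolution.succ m) c
  have hface : ∀ j, l' ≫ face T.obj j = if j = 0 then p ≫ l else 0 := by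
    intro j
    have h := congrArg (· ≫ FaceFamilies.proj T.obj ⟨j, Finset.mem_univ j⟩) hl'
    simp only [Category.assoc, toFaceFamilies, c, FaceFamilies.lift_proj] at h
    rw [h]
    split_ifs <;> simp
  refine .of_regularEpi p hp ?_
  have hzero := T.cooperates_face (k := k ≫ degeneracy T.obj 0) (l := l') 0 ?_ ?_
  · rwa [hface, if_pos rfl, Category.assoc,
      degeneracy_face_eq_id _ _ _ (.inl Fin.castSucc_zero.symm), Category.comp_id] at hzero
  · intro j hj
    rw [hface, if_neg hj]
    exact .zero_right _
  · have : l' ≫ T.toBase _ = 0 := by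
      rw [← T.map_toBase (AugOrd.ofHom (Fin.succAboveOrderEmb (0 : Fin (m + 2))).toOrderHom).op,
        ← Category.assoc]
      change (l' ≫ face T.obj 0) ≫ _ = 0
      rw [hface, if_pos rfl, Category.assoc, T.comp_toBase_eq_zero (hl 0), comp_zero]
    rw [this]
    exact .zero_right _

theorem exists_castSucc_succ_mem_ne {m : ℕ} (I : Finset (Fin (m + 1))) (h : I.Nonempty)
    (h' : Iᶜ.Nonempty) : ∃ j : Fin m, ¬ (j.castSucc ∈ I ↔ j.succ ∈ I) := by
  by_contra! hI
  have key : ∀ i : Fin (m + 1), i ∈ I ↔ 0 ∈ I := by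
    intro i
    induction i using Fin.induction with
    | zero => rfl
    | succ i ih => rw [← hI, ih]
  obtain ⟨a, ha⟩ := h
  obtain ⟨b, hb⟩ := h'
  exact Finset.mem_compl.1 hb ((key b).2 ((key a).1 ha))

/-- The morphisms from `⋂_{i ∈ I} K[∂_i]` and from `⋂_{i ∉ I} K[∂_i]` to `T_{n - 1}` cooperate. -/
theorem Torsor.cooperates (I : Finset (Fin (m + 1)))
    {k : K ⟶ T.obj.deg (m + 1)} {l : L ⟶ T.obj.deg (m + 1)}
    (hk : ∀ i ∈ I, k ≫ face T.obj i = 0) (hl : ∀ i ∉ I, l ≫ face T.obj i = 0) :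
    Cooperates k l := by
  rcases I.eq_empty_or_nonempty with rfl | h
  · exact T.cooperates_of_forall_face_eq_zero k fun i => hl i (Finset.notMem_empty i)
  rcases Iᶜ.eq_empty_or_nonempty with h₂ | h₂
  · exact (T.cooperates_of_forall_face_eq_zero l fun i => hk i
      (by rw [Finset.compl_eq_empty_iff] at h₂; simp [h₂])).symm
  obtain ⟨j, hj⟩ := exists_castSucc_succ_mem_ne I h h₂
  by_cases hj' : j.succ ∈ I
  · exact T.cooperates_of_notMem_of_mem I hk hl j (by tauto) hj'
  · exact (T.cooperates_of_notMem_of_mem Iᶜ (fun i hi => hl i (Finset.mem_compl.1 hi))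
      (fun i hi => hk i (by simpa using hi)) j (by simp; tauto) (by simpa using hj')).symm

end Torsor

end Horn

/-! ### Local fillers of boundary families -/

section Fillers

variable {C : Type u} [Category.{v} C] {P : Type*} [PartialOrder P]

/-- The restriction `F_J ⟶ F_K` of a presheaf `F` on a poset along `K ≤ J`. -/
def restr (F : Pᵒᵖ ⥤ C) {K J : P} (h : K ≤ J) : F.obj (op J) ⟶ F.obj (op K) :=
  F.map (homOfLE h).op

theorem restr_refl (F : Pᵒᵖ ⥤ C) (J : P) : restr F (le_refl J) = 𝟙 _ :=
  F.map_id _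

theorem restr_comp_restr (F : Pᵒᵖ ⥤ C) {K J I : P} (h : K ≤ J) (h' : J ≤ I) :
    restr F h' ≫ restr F h = restr F (h.trans h') :=
  (F.map_comp _ _).symm

theorem restr_naturality {F G : Pᵒᵖ ⥤ C} (f : F ⟶ G) {K J : P} (h : K ≤ J) :
    restr F h ≫ f.app (op K) = f.app (op J) ≫ restr G h :=
  f.naturality _

/-- A compatible family of generalized elements `W ⟶ F_J`, for `J < I`: a generalized element of
the limit of the `F_J`. -/
structure BoundaryFamily (F : Pᵒᵖ ⥤ C) (I : P) (W : C) where
  /-- the members of the family -/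
  val : ∀ J, J < I → (W ⟶ F.obj (op J))
  val_restr : ∀ {J K : P} (hJ : J < I) (hKJ : K ≤ J),
    val J hJ ≫ restr F hKJ = val K (hKJ.trans_lt hJ)

namespace BoundaryFamily

variable {F G : Pᵒᵖ ⥤ C} {I : P} {W : C}

/-- The image of a compatible family under a natural transformation. -/
def map (x : BoundaryFamily F I W) (f : F ⟶ G) : BoundaryFamily G I W where
  val J hJ := x.val J hJ ≫ f.app (op J)
  val_restr hJ hKJ := by
    rw [Category.assoc, ← restr_naturality, ← Category.assoc, x.val_restr]

/-- The restriction of a compatible family along a change of its domain of definition. -/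
def precomp (x : BoundaryFamily F I W) {W' : C} (p : W' ⟶ W) : BoundaryFamily F I W' where
  val J hJ := p ≫ x.val J hJ
  val_restr hJ hKJ := by rw [Category.assoc, x.val_restr]

end BoundaryFamily

/-- Every compatible family of elements `F_J`, for `J < I`, comes locally from an element of `F_I`:
the matching morphism from `F_I` to the limit of the `F_J` is a regular epimorphism. -/
def HasLocalFillers (F : Pᵒᵖ ⥤ C) : Prop :=
  ∀ ⦃I : P⦄ ⦃W : C⦄ (x : BoundaryFamily F I W), ∃ (W' : C) (p : W' ⟶ W) (z : W' ⟶ F.obj (op I)),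
    IsRegularEpi p ∧ ∀ J (hJ : J < I), z ≫ restr F hJ.le = p ≫ x.val J hJ

/-- The relative version of `HasLocalFillers`, for a morphism `f : F ⟶ G`: compatible families in
`F`, of which the image in `G` comes from `y : W ⟶ G_I`, come locally from an element of `F_I` over
`y`. -/
def HasRelativeLocalFillers {F G : Pᵒᵖ ⥤ C} (f : F ⟶ G) : Prop :=
  ∀ ⦃I : P⦄ ⦃W : C⦄ (x : BoundaryFamily F I W) (y : W ⟶ G.obj (op I)),
    (∀ J (hJ : J < I), x.val J hJ ≫ f.app (op J) = y ≫ restr G hJ.le) →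
    ∃ (W' : C) (p : W' ⟶ W) (z : W' ⟶ F.obj (op I)), IsRegularEpi p ∧ z ≫ f.app (op I) = p ≫ y ∧
      ∀ J (hJ : J < I), z ≫ restr F hJ.le = p ≫ x.val J hJ

variable [Regular C]

theorem HasRelativeLocalFillers.hasLocalFillers {F G : Pᵒᵖ ⥤ C} {f : F ⟶ G}
    (hf : HasRelativeLocalFillers f) (hG : HasLocalFillers G) : HasLocalFillers F := by
  intro I W x
  obtain ⟨W₁, p₁, y, hp₁, hy⟩ := hG (x.map f)
  obtain ⟨W₂, p₂, z, hp₂, -, hz⟩ := hf (x.precomp p₁) y fun J hJ => by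
    rw [hy]; exact Category.assoc _ _ _
  exact ⟨W₂, p₂ ≫ p₁, z, isRegularEpi_comp _ _ hp₂ hp₁, fun J hJ => by
    rw [hz, Category.assoc]; rfl⟩

theorem HasRelativeLocalFillers.hasLocalFillers_of_isPullback {A B D Q : Pᵒᵖ ⥤ C} {a : Q ⟶ A}
    {d : Q ⟶ D} {f : A ⟶ B} {g : D ⟶ B} (hQ : IsPullback a d f g)
    (hf : HasRelativeLocalFillers f) (hD : HasLocalFillers D) : HasLocalFillers Q := by
  have hQ' : ∀ I : P, IsPullback (a.app (op I)) (d.app (op I)) (f.app (op I)) (g.app (op I)) :=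
    fun I => hQ.map ((evaluation Pᵒᵖ C).obj (op I))
  intro I W x
  obtain ⟨W₁, p₁, y, hp₁, hy⟩ := hD (x.map d)
  obtain ⟨W₂, p₂, z, hp₂, hzy, hz⟩ := hf ((x.map a).precomp p₁) (y ≫ g.app (op I)) fun J hJ => by
    rw [Category.assoc, ← restr_naturality, ← Category.assoc, hy J hJ]
    simp only [BoundaryFamily.precomp, BoundaryFamily.map, Category.assoc, (hQ' J).w]
  refine ⟨W₂, p₂ ≫ p₁, (hQ' I).lift z (p₂ ≫ y) (by rw [hzy, Category.assoc]),
    isRegularEpi_comp _ _ hp₂ hp₁, fun J hJ => (hQ' J).hom_ext ?_ ?_⟩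
  · rw [Category.assoc, restr_naturality, ← Category.assoc, IsPullback.lift_fst, hz J hJ]
    simp only [BoundaryFamily.precomp, BoundaryFamily.map, Category.assoc]
  · rw [Category.assoc, restr_naturality, ← Category.assoc, IsPullback.lift_snd, Category.assoc,
      hy J hJ]
    simp only [BoundaryFamily.map, Category.assoc]

end Fillers

/-! ### Local fillers of domains and codomains of higher arrows -/

section DomCod

theorem codIncl_le_codIncl {n : ℕ} {J I : Finset (Fin n)} :
    (codIncl n).obj J ≤ (codIncl n).obj I ↔ J ≤ I :=
  Finset.map_subset_map

theorem last_notMem_codIncl {n : ℕ} (I : Finset (Fin n)) : Fin.last n ∉ (codIncl n).obj I := by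
  change Fin.last n ∉ I.map Fin.castSuccEmb
  simp

theorem last_mem_domIncl {n : ℕ} (I : Finset (Fin n)) : Fin.last n ∈ (domIncl n).obj I :=
  Finset.mem_insert_self _ _

theorem codIncl_le_domIncl {n : ℕ} {J I : Finset (Fin n)} :
    (codIncl n).obj J ≤ (domIncl n).obj I ↔ J ≤ I :=
  (Finset.subset_insert_iff_of_notMem (last_notMem_codIncl J)).trans codIncl_le_codIncl

theorem domIncl_le_domIncl {n : ℕ} {J I : Finset (Fin n)} :
    (domIncl n).obj J ≤ (domIncl n).obj I ↔ J ≤ I :=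
  (Finset.insert_subset_insert_iff (last_notMem_codIncl J)).trans codIncl_le_codIncl

theorem not_domIncl_le_codIncl {n : ℕ} {J I : Finset (Fin n)} :
    ¬ (domIncl n).obj J ≤ (codIncl n).obj I :=
  fun h => last_notMem_codIncl I (h (last_mem_domIncl J))

theorem domIncl_lt_domIncl {n : ℕ} {J I : Finset (Fin n)} :
    (domIncl n).obj J < (domIncl n).obj I ↔ J < I := by
  simp only [lt_iff_le_not_ge, domIncl_le_domIncl]

theorem codIncl_lt_codIncl {n : ℕ} {J I : Finset (Fin n)} :
    (codIncl n).obj J < (codIncl n).obj I ↔ J < I := by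
  simp only [lt_iff_le_not_ge, codIncl_le_codIncl]

theorem codIncl_lt_domIncl {n : ℕ} {J I : Finset (Fin n)} :
    (codIncl n).obj J < (domIncl n).obj I ↔ J ≤ I := by
  simp only [lt_iff_le_not_ge, codIncl_le_domIncl, not_domIncl_le_codIncl, not_false_eq_true,
    and_true]

theorem exists_eq_codIncl_or_eq_domIncl {n : ℕ} (J : Finset (Fin (n + 1))) :
    ∃ J', J = (codIncl n).obj J' ∨ J = (domIncl n).obj J' := by
  refine ⟨Finset.univ.filter fun i => i.castSucc ∈ J, ?_⟩
  by_cases h : Fin.last n ∈ J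
  · right
    change J = insert (Fin.last n) (Finset.map Fin.castSuccEmb _)
    ext i
    induction i using Fin.lastCases with
    | last => simp [h]
    | cast i => simp
  · left
    change J = Finset.map Fin.castSuccEmb _
    ext i
    induction i using Fin.lastCases with
    | last => simp [h]
    | cast i => simp

variable {C : Type u} [Category.{v} C] {n : ℕ} {I : Finset (Fin n)} {W : C}

theorem codIncl_le_domIncl_self (I : Finset (Fin n)) : (codIncl n).obj I ≤ (domIncl n).obj I :=
  codIncl_le_domIncl.2 le_rfl

section Families

variable {F G : Cube C (n + 1)} {f : F ⟶ G}

/-- A compatible family in `cod F` below `I` is a compatible family in `F`. -/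
theorem BoundaryFamily.exists_of_cod (x : ∀ J, J < I → (W ⟶ F.obj (op ((codIncl n).obj J))))
    (hx : ∀ {J K} (hJ : J < I) (hKJ : K ≤ J),
      x J hJ ≫ restr F (codIncl_le_codIncl.2 hKJ) = x K (hKJ.trans_lt hJ)) :
    ∃ z : BoundaryFamily F ((codIncl n).obj I) W,
      ∀ J (hJ : J < I), z.val _ (codIncl_lt_codIncl.2 hJ) = x J hJ := by
  have hc : ∀ J, J < (codIncl n).obj I → ∃ J', J = (codIncl n).obj J' := fun J hJ => by
    obtain ⟨J', rfl | rfl⟩ := exists_eq_codIncl_or_eq_domIncl J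
    · exact ⟨J', rfl⟩
    · exact absurd hJ.le not_domIncl_le_codIncl
  let val : ∀ J, J < (codIncl n).obj I → (W ⟶ F.obj (op J)) := fun J hJ =>
    x (hc J hJ).choose (codIncl_lt_codIncl.1 ((hc J hJ).choose_spec ▸ hJ)) ≫
      restr F (hc J hJ).choose_spec.le
  have hval : ∀ J (hJ : J < I), val _ (codIncl_lt_codIncl.2 hJ) = x J hJ := fun J hJ =>
    hx _ (codIncl_le_codIncl.1 (hc _ (codIncl_lt_codIncl.2 hJ)).choose_spec.le)
  refine ⟨⟨val, fun {J K} hJ hKJ => ?_⟩, hval⟩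
  obtain ⟨J, rfl⟩ := hc J hJ
  obtain ⟨K, rfl⟩ := hc K (hKJ.trans_lt hJ)
  rw [hval J (codIncl_lt_codIncl.1 hJ),
    hval K ((codIncl_le_codIncl.1 hKJ).trans_lt (codIncl_lt_codIncl.1 hJ))]
  exact hx _ (codIncl_le_codIncl.1 hKJ)

/-- The proper subsets of `I ∪ {n}` are the `J ∪ {n}` for `J < I`, and the subsets of `I`. Hence a
compatible family in `dom F` below `I` and an element of `cod F` at `I` with the same boundary
in `cod F` form a compatible family in `F` below `I ∪ {n}`. -/
theorem BoundaryFamily.exists_glue (x : ∀ J, J < I → (W ⟶ F.obj (op ((domIncl n).obj J))))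
    (hx : ∀ {J K} (hJ : J < I) (hKJ : K ≤ J),
      x J hJ ≫ restr F (domIncl_le_domIncl.2 hKJ) = x K (hKJ.trans_lt hJ))
    (y : W ⟶ F.obj (op ((codIncl n).obj I)))
    (h : ∀ J (hJ : J < I), x J hJ ≫ restr F (codIncl_le_domIncl_self J) =
      y ≫ restr F (codIncl_le_codIncl.2 hJ.le)) :
    ∃ z : BoundaryFamily F ((domIncl n).obj I) W,
      (∀ J (hJ : J < I), z.val _ (domIncl_lt_domIncl.2 hJ) = x J hJ) ∧
      ∀ J (hJ : J ≤ I), z.val _ (codIncl_lt_domIncl.2 hJ) =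
        y ≫ restr F (codIncl_le_codIncl.2 hJ) := by
  classical
  have hc : ∀ J, J < (domIncl n).obj I → (¬ ∃ J', J = (domIncl n).obj J') →
      J ≤ (codIncl n).obj I := fun J hJ h => by
    obtain ⟨J', rfl | rfl⟩ := exists_eq_codIncl_or_eq_domIncl J
    · exact codIncl_le_codIncl.2 (codIncl_lt_domIncl.1 hJ)
    · exact absurd ⟨J', rfl⟩ h
  let val : ∀ J, J < (domIncl n).obj I → (W ⟶ F.obj (op J)) := fun J hJ =>
    if h : ∃ J', J = (domIncl n).obj J' then
      x h.choose (domIncl_lt_domIncl.1 (h.choose_spec ▸ hJ)) ≫ restr F h.choose_spec.le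
    else y ≫ restr F (hc J hJ h)
  have hdom : ∀ J (hJ : J < I), val _ (domIncl_lt_domIncl.2 hJ) = x J hJ := fun J hJ => by
    have hJ' : ∃ J', (domIncl n).obj J = (domIncl n).obj J' := ⟨J, rfl⟩
    exact (dif_pos hJ').trans (hx _ (domIncl_le_domIncl.1 hJ'.choose_spec.le))
  have hcod : ∀ J (hJ : J ≤ I), val _ (codIncl_lt_domIncl.2 hJ) =
      y ≫ restr F (codIncl_le_codIncl.2 hJ) := fun J hJ => by
    refine dif_neg ?_
    rintro ⟨J', hJ'⟩
    exact not_domIncl_le_codIncl hJ'.ge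
  refine ⟨⟨val, fun {J K} hJ hKJ => ?_⟩, hdom, hcod⟩
  obtain ⟨J, rfl | rfl⟩ := exists_eq_codIncl_or_eq_domIncl J <;>
    obtain ⟨K, rfl | rfl⟩ := exists_eq_codIncl_or_eq_domIncl K
  · have hJ' := codIncl_lt_domIncl.1 hJ
    have hKJ' := codIncl_le_codIncl.1 hKJ
    rw [hcod J hJ', hcod K (hKJ'.trans hJ'), Category.assoc, restr_comp_restr]
  · exact absurd hKJ not_domIncl_le_codIncl
  · have hJ' := domIncl_lt_domIncl.1 hJ
    have hKJ' := codIncl_le_domIncl.1 hKJ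
    rw [hdom J hJ', hcod K (hKJ'.trans hJ'.le),
      ← restr_comp_restr F (codIncl_le_codIncl.2 hKJ') (codIncl_le_codIncl.2 hJ'.le),
      ← Category.assoc, ← h J hJ', Category.assoc, restr_comp_restr]
  · have hJ' := domIncl_lt_domIncl.1 hJ
    have hKJ' := domIncl_le_domIncl.1 hKJ
    rw [hdom J hJ', hdom K (hKJ'.trans_lt hJ')]
    exact hx hJ' hKJ'

/-! The following statements concern `dom F` and `cod F`, but are spelled out in terms of the values
of `F` at `I ∪ {n}` and at `I`. -/

theorem HasLocalFillers.exists_cod (hF : HasLocalFillers F)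
    (x : ∀ J, J < I → (W ⟶ F.obj (op ((codIncl n).obj J))))
    (hx : ∀ {J K} (hJ : J < I) (hKJ : K ≤ J),
      x J hJ ≫ restr F (codIncl_le_codIncl.2 hKJ) = x K (hKJ.trans_lt hJ)) :
    ∃ (W' : C) (p : W' ⟶ W) (z : W' ⟶ F.obj (op ((codIncl n).obj I))), IsRegularEpi p ∧
      ∀ J (hJ : J < I), z ≫ restr F (codIncl_le_codIncl.2 hJ.le) = p ≫ x J hJ := by
  obtain ⟨x', hx'⟩ := BoundaryFamily.exists_of_cod x hx
  obtain ⟨W', p, z, hp, hz⟩ := hF x'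
  exact ⟨W', p, z, hp, fun J hJ => by rw [← hx', ← hz]⟩

theorem HasRelativeLocalFillers.exists_cod (hf : HasRelativeLocalFillers f)
    (x : ∀ J, J < I → (W ⟶ F.obj (op ((codIncl n).obj J))))
    (hx : ∀ {J K} (hJ : J < I) (hKJ : K ≤ J),
      x J hJ ≫ restr F (codIncl_le_codIncl.2 hKJ) = x K (hKJ.trans_lt hJ))
    (b : W ⟶ G.obj (op ((codIncl n).obj I)))
    (hxb : ∀ J (hJ : J < I), x J hJ ≫ f.app _ = b ≫ restr G (codIncl_le_codIncl.2 hJ.le)) :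
    ∃ (W' : C) (p : W' ⟶ W) (z : W' ⟶ F.obj (op ((codIncl n).obj I))), IsRegularEpi p ∧
      z ≫ f.app _ = p ≫ b ∧
      ∀ J (hJ : J < I), z ≫ restr F (codIncl_le_codIncl.2 hJ.le) = p ≫ x J hJ := by
  obtain ⟨x', hx'⟩ := BoundaryFamily.exists_of_cod x hx
  obtain ⟨W', p, z, hp, hzb, hz⟩ := hf x' b fun J hJ => by
    obtain ⟨J, rfl | rfl⟩ := exists_eq_codIncl_or_eq_domIncl J
    · rw [hx' J (codIncl_lt_codIncl.1 hJ), hxb]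
    · exact absurd hJ.le not_domIncl_le_codIncl
  exact ⟨W', p, z, hp, hzb, fun J hJ => by rw [← hx', ← hz]⟩

theorem HasLocalFillers.exists_dom (hF : HasLocalFillers F)
    (x : ∀ J, J < I → (W ⟶ F.obj (op ((domIncl n).obj J))))
    (hx : ∀ {J K} (hJ : J < I) (hKJ : K ≤ J),
      x J hJ ≫ restr F (domIncl_le_domIncl.2 hKJ) = x K (hKJ.trans_lt hJ))
    (y : W ⟶ F.obj (op ((codIncl n).obj I)))
    (h : ∀ J (hJ : J < I), x J hJ ≫ restr F (codIncl_le_domIncl_self J) =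
      y ≫ restr F (codIncl_le_codIncl.2 hJ.le)) :
    ∃ (W' : C) (p : W' ⟶ W) (z : W' ⟶ F.obj (op ((domIncl n).obj I))), IsRegularEpi p ∧
      z ≫ restr F (codIncl_le_domIncl_self I) = p ≫ y ∧
      ∀ J (hJ : J < I), z ≫ restr F (domIncl_le_domIncl.2 hJ.le) = p ≫ x J hJ := by
  obtain ⟨x', hx', hy'⟩ := BoundaryFamily.exists_glue x hx y h
  obtain ⟨W', p, z, hp, hz⟩ := hF x'
  refine ⟨W', p, z, hp, ?_, fun J hJ => by rw [← hx', ← hz]⟩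
  rw [hz _ (codIncl_lt_domIncl.2 le_rfl), hy' I le_rfl, restr_refl, Category.comp_id]

theorem HasRelativeLocalFillers.exists_dom (hf : HasRelativeLocalFillers f)
    (x : ∀ J, J < I → (W ⟶ F.obj (op ((domIncl n).obj J))))
    (hx : ∀ {J K} (hJ : J < I) (hKJ : K ≤ J),
      x J hJ ≫ restr F (domIncl_le_domIncl.2 hKJ) = x K (hKJ.trans_lt hJ))
    (y : W ⟶ F.obj (op ((codIncl n).obj I)))
    (h : ∀ J (hJ : J < I), x J hJ ≫ restr F (codIncl_le_domIncl_self J) =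
      y ≫ restr F (codIncl_le_codIncl.2 hJ.le))
    (b : W ⟶ G.obj (op ((domIncl n).obj I)))
    (hyb : y ≫ f.app _ = b ≫ restr G (codIncl_le_domIncl_self I))
    (hxb : ∀ J (hJ : J < I), x J hJ ≫ f.app _ = b ≫ restr G (domIncl_le_domIncl.2 hJ.le)) :
    ∃ (W' : C) (p : W' ⟶ W) (z : W' ⟶ F.obj (op ((domIncl n).obj I))), IsRegularEpi p ∧
      z ≫ f.app _ = p ≫ b ∧ z ≫ restr F (codIncl_le_domIncl_self I) = p ≫ y ∧
      ∀ J (hJ : J < I), z ≫ restr F (domIncl_le_domIncl.2 hJ.le) = p ≫ x J hJ := by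
  obtain ⟨x', hx', hy'⟩ := BoundaryFamily.exists_glue x hx y h
  obtain ⟨W', p, z, hp, hzb, hz⟩ := hf x' b fun J hJ => by
    obtain ⟨J, rfl | rfl⟩ := exists_eq_codIncl_or_eq_domIncl J
    · rw [hy' J (codIncl_lt_domIncl.1 hJ), Category.assoc, restr_naturality, ← Category.assoc, hyb,
        Category.assoc, restr_comp_restr]
    · rw [hx' J (domIncl_lt_domIncl.1 hJ), hxb]
  refine ⟨W', p, z, hp, hzb, ?_, fun J hJ => by rw [← hx', ← hz]⟩
  rw [hz _ (codIncl_lt_domIncl.2 le_rfl), hy' I le_rfl, restr_refl, Category.comp_id]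

variable [Regular C]

/-- A boundary family in `dom F` over `b` is filled in two steps: its image in `cod F` is filled
over the restriction of `b`, and the result is glued to the given family. -/
theorem HasRelativeLocalFillers.exists_dom_of_forall (hf : HasRelativeLocalFillers f)
    (x : ∀ J, J < I → (W ⟶ F.obj (op ((domIncl n).obj J))))
    (hx : ∀ {J K} (hJ : J < I) (hKJ : K ≤ J),
      x J hJ ≫ restr F (domIncl_le_domIncl.2 hKJ) = x K (hKJ.trans_lt hJ))
    (b : W ⟶ G.obj (op ((domIncl n).obj I)))
    (hxb : ∀ J (hJ : J < I), x J hJ ≫ f.app _ = b ≫ restr G (domIncl_le_domIncl.2 hJ.le)) :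
    ∃ (W' : C) (p : W' ⟶ W) (z : W' ⟶ F.obj (op ((domIncl n).obj I))), IsRegularEpi p ∧
      z ≫ f.app _ = p ≫ b ∧
      ∀ J (hJ : J < I), z ≫ restr F (domIncl_le_domIncl.2 hJ.le) = p ≫ x J hJ := by
  obtain ⟨W₁, p₁, y, hp₁, hyb, hy⟩ := hf.exists_cod
    (fun J hJ => x J hJ ≫ restr F (codIncl_le_domIncl_self J))
    (fun hJ hKJ => by
      rw [← hx hJ hKJ, Category.assoc, Category.assoc, restr_comp_restr, restr_comp_restr])
    (b ≫ restr G (codIncl_le_domIncl_self I)) fun J hJ => by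
      rw [Category.assoc, restr_naturality, ← Category.assoc, hxb, Category.assoc, Category.assoc,
        restr_comp_restr, restr_comp_restr]
  obtain ⟨W₂, p₂, z, hp₂, hzb, -, hz⟩ := hf.exists_dom (fun J hJ => p₁ ≫ x J hJ)
    (fun hJ hKJ => by rw [Category.assoc, hx hJ hKJ]) y
    (fun J hJ => by rw [hy J hJ, Category.assoc]) (p₁ ≫ b) (by rw [hyb, Category.assoc])
    (fun J hJ => by rw [Category.assoc, Category.assoc, hxb])
  exact ⟨W₂, p₂ ≫ p₁, z, isRegularEpi_comp _ _ hp₂ hp₁, by rw [hzb, Category.assoc],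
    fun J hJ => by rw [hz, Category.assoc]⟩

end Families

section Functors

variable {F G : Cube C (n + 1)} {f : F ⟶ G}

theorem HasLocalFillers.cod (hF : HasLocalFillers F) :
    HasLocalFillers ((codFunctor C n).obj F) :=
  fun _ _ x => hF.exists_cod x.val x.val_restr

theorem HasRelativeLocalFillers.cod (hf : HasRelativeLocalFillers f) :
    HasRelativeLocalFillers ((codFunctor C n).map f) :=
  fun _ _ x b hxb => hf.exists_cod x.val x.val_restr b hxb

theorem HasLocalFillers.arrowOf_app (hF : HasLocalFillers F) :
    HasRelativeLocalFillers ((arrowOf C n).app F) :=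
  fun _ _ x y hxy => hF.exists_dom x.val x.val_restr y hxy

variable [Regular C]

theorem HasLocalFillers.dom (hF : HasLocalFillers F) :
    HasLocalFillers ((domFunctor C n).obj F) :=
  hF.arrowOf_app.hasLocalFillers hF.cod

theorem HasRelativeLocalFillers.dom (hf : HasRelativeLocalFillers f) :
    HasRelativeLocalFillers ((domFunctor C n).map f) :=
  fun _ _ x b hxb => hf.exists_dom_of_forall x.val x.val_restr b hxb

omit [Regular C] in
/-- An element `y` of the pullback `Q = cod F ×_{cod G} dom G` at `I` and a compatible family in
`dom F` over it combine into a compatible family in `F` below `I ∪ {n}` over an element of `G` at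
`I ∪ {n}`. -/
theorem HasRelativeLocalFillers.exists_comparison (hf : HasRelativeLocalFillers f) {Q : Cube C n}
    (a : ∀ I, Q.obj (op I) ⟶ F.obj (op ((codIncl n).obj I)))
    (d : ∀ I, Q.obj (op I) ⟶ G.obj (op ((domIncl n).obj I)))
    (ha : ∀ {J I} (h : J ≤ I), restr Q h ≫ a J = a I ≫ restr F (codIncl_le_codIncl.2 h))
    (hd : ∀ {J I} (h : J ≤ I), restr Q h ≫ d J = d I ≫ restr G (domIncl_le_domIncl.2 h))
    (hQ : ∀ I, IsPullback (a I) (d I) (f.app (op ((codIncl n).obj I)))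
      (restr G (codIncl_le_domIncl_self I)))
    (c : ∀ I, F.obj (op ((domIncl n).obj I)) ⟶ Q.obj (op I))
    (hca : ∀ I, c I ≫ a I = restr F (codIncl_le_domIncl_self I))
    (hcd : ∀ I, c I ≫ d I = f.app (op ((domIncl n).obj I)))
    (x : ∀ J, J < I → (W ⟶ F.obj (op ((domIncl n).obj J))))
    (hx : ∀ {J K} (hJ : J < I) (hKJ : K ≤ J),
      x J hJ ≫ restr F (domIncl_le_domIncl.2 hKJ) = x K (hKJ.trans_lt hJ))
    (y : W ⟶ Q.obj (op I)) (hxy : ∀ J (hJ : J < I), x J hJ ≫ c J = y ≫ restr Q hJ.le) :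
    ∃ (W' : C) (p : W' ⟶ W) (z : W' ⟶ F.obj (op ((domIncl n).obj I))), IsRegularEpi p ∧
      z ≫ c I = p ≫ y ∧
      ∀ J (hJ : J < I), z ≫ restr F (domIncl_le_domIncl.2 hJ.le) = p ≫ x J hJ := by
  obtain ⟨W', p, z, hp, hzb, hzy, hz⟩ := hf.exists_dom x hx (y ≫ a I)
    (fun J hJ => by rw [← hca, ← Category.assoc, hxy, Category.assoc, Category.assoc, ha])
    (y ≫ d I) (by rw [Category.assoc, (hQ I).w, Category.assoc])
    (fun J hJ => by rw [← hcd, ← Category.assoc, hxy, Category.assoc, Category.assoc, hd])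
  refine ⟨W', p, z, hp, (hQ I).hom_ext ?_ ?_, hz⟩
  · rw [Category.assoc, hca, hzy, Category.assoc]
  · rw [Category.assoc, hcd, hzb, Category.assoc]

theorem HasRelativeLocalFillers.comparison (hf : HasRelativeLocalFillers f) {Q : Cube C n}
    {a : Q ⟶ (codFunctor C n).obj F} {d : Q ⟶ (domFunctor C n).obj G}
    (hQ : IsPullback a d ((codFunctor C n).map f) ((arrowOf C n).app G))
    {c : (domFunctor C n).obj F ⟶ Q} (hca : c ≫ a = (arrowOf C n).app F)
    (hcd : c ≫ d = (domFunctor C n).map f) : HasRelativeLocalFillers c :=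
  fun _ _ x y hxy => hf.exists_comparison (fun I => a.app (op I)) (fun I => d.app (op I))
    (fun h => restr_naturality a h) (fun h => restr_naturality d h)
    (fun I => hQ.map ((evaluation _ C).obj (op I))) (fun I => c.app (op I))
    (fun I => congrArg (fun g => g.app (op I)) hca) (fun I => congrArg (fun g => g.app (op I)) hcd)
    x.val x.val_restr y hxy

end Functors

variable [Regular C]

/-- A morphism of `n`-fold arrows with relative local fillers, and with local fillers in its
codomain, is an `(n + 1)`-cubic extension: both conditions are inherited by the five morphisms in
the definition of a cubic extension. -/
theorem HasRelativeLocalFillers.isCubicExtensionArrow :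
    ∀ {n : ℕ} {F G : Cube C n} {f : F ⟶ G}, HasRelativeLocalFillers f → HasLocalFillers G →
      IsCubicExtensionArrow n f
  | 0, F, G, f, hf, _ => by
    have hemp : ∀ J : Finset (Fin 0), ¬ J < ∅ := fun J hJ => Finset.not_ssubset_empty J hJ
    obtain ⟨W, p, z, hp, hz, -⟩ := hf (I := ∅) (W := G.obj (op ∅))
      ⟨fun J hJ => absurd hJ (hemp J), fun {J} _ hJ => absurd hJ (hemp J)⟩ (𝟙 _)
      fun J hJ => absurd hJ (hemp J)
    exact isRegularEpi_of_exists_lift ⟨W, p, z, hp, hz.trans (Category.comp_id _)⟩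
  | n + 1, F, G, f, hf, hG => by
    have hF := hf.hasLocalFillers hG
    exact ⟨hF.arrowOf_app.isCubicExtensionArrow hF.cod, hG.arrowOf_app.isCubicExtensionArrow hG.cod,
      hf.dom.isCubicExtensionArrow hG.dom, hf.cod.isCubicExtensionArrow hG.cod,
      (hf.comparison (.of_hasPullback _ _) (pullback.lift_fst _ _ _)
        (pullback.lift_snd _ _ _)).isCubicExtensionArrow
        (hf.cod.hasLocalFillers_of_isPullback (.of_hasPullback _ _) hG.dom)⟩

theorem HasLocalFillers.isCubicExtension {n : ℕ} {F : Cube C n} (hF : HasLocalFillers F) :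
    IsCubicExtension n F := by
  cases n with
  | zero => trivial
  | succ n => exact hF.arrowOf_app.isCubicExtensionArrow hF.cod

end DomCod

/-! ### Local fillers for resolutions -/

section Resolution

variable {C : Type u} [Category.{v} C]

/-- The order preserving function to `{0, …, |J| - 1}` which corresponds to an order preserving
function `g` with values in `J`, under the order isomorphism of `{0, …, |J| - 1}` and `J`. -/
def toCard {n a : ℕ} (J : Finset (Fin n)) (g : Fin a →o Fin n) (h : ∀ x, g x ∈ J) :
    Fin a →o Fin J.card where
  toFun x := (J.orderIsoOfFin rfl).symm ⟨g x, h x⟩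
  monotone' _ _ hxy := (J.orderIsoOfFin rfl).symm.monotone (g.monotone hxy)

/-- The order preserving enumeration of `J`. -/
def ofCard {n : ℕ} (J : Finset (Fin n)) : Fin J.card →o Fin n where
  toFun x := J.orderIsoOfFin rfl x
  monotone' _ _ hxy := (J.orderIsoOfFin rfl).monotone hxy

theorem ofCard_mem {n : ℕ} (J : Finset (Fin n)) (x : Fin J.card) : ofCard J x ∈ J :=
  (J.orderIsoOfFin rfl x).2

theorem ofCard_injective {n : ℕ} (J : Finset (Fin n)) : Function.Injective (ofCard J) :=
  fun _ _ h => (J.orderIsoOfFin rfl).injective (Subtype.ext h)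

theorem exists_ofCard_eq {n : ℕ} {J : Finset (Fin n)} {i : Fin n} (h : i ∈ J) :
    ∃ x, ofCard J x = i :=
  ⟨(J.orderIsoOfFin rfl).symm ⟨i, h⟩, congrArg Subtype.val (OrderIso.apply_symm_apply _ _)⟩

theorem ofCard_comp_toCard {n a : ℕ} (J : Finset (Fin n)) (g : Fin a →o Fin n)
    (h : ∀ x, g x ∈ J) : (ofCard J).comp (toCard J g h) = g :=
  OrderHom.ext _ _ (funext fun _ => congrArg Subtype.val (OrderIso.apply_symm_apply _ _))

theorem ofCard_comp_injective {n a : ℕ} {J : Finset (Fin n)} {θ η : Fin a →o Fin J.card}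
    (h : (ofCard J).comp θ = (ofCard J).comp η) : θ = η :=
  OrderHom.ext _ _ (funext fun x => ofCard_injective J (DFunLike.congr_fun h x))

/-- The order preserving function `|K| ⟶ |J|` which corresponds to an inclusion `K ⊆ J`. -/
def cardHom {n : ℕ} {K J : Finset (Fin n)} (h : K ≤ J) : Fin K.card →o Fin J.card :=
  toCard J (ofCard K) fun x => h (ofCard_mem K x)

theorem ofCard_comp_cardHom {n : ℕ} {K J : Finset (Fin n)} (h : K ≤ J) :
    (ofCard J).comp (cardHom h) = ofCard K :=
  ofCard_comp_toCard _ _ _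

theorem cardHom_comp_toCard {n a : ℕ} {K J : Finset (Fin n)} (h : K ≤ J) (g : Fin a →o Fin n)
    (hg : ∀ x, g x ∈ K) : (cardHom h).comp (toCard K g hg) = toCard J g fun x => h (hg x) := by
  apply ofCard_comp_injective
  rw [ofCard_comp_toCard, ← OrderHom.comp_assoc, ofCard_comp_cardHom, ofCard_comp_toCard]

theorem toCard_ofCard {n : ℕ} (J : Finset (Fin n)) :
    toCard J (ofCard J) (ofCard_mem J) = OrderHom.id :=
  ofCard_comp_injective (ofCard_comp_toCard _ _ _)

theorem map_ofHom_id (X : AugSimplicial C) (a : ℕ) :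
    X.map (AugOrd.ofHom (OrderHom.id : Fin a →o Fin a)).op = 𝟙 _ :=
  X.map_id _

variable [HasZeroMorphisms C] [Regular C]

/-- In a resolution, every compatible family indexed by the non-surjective order preserving
functions to `{0, …, b - 1}` comes locally from an element in absolute degree `b`: such a family is
determined by its members at the coface maps, which form a cycle. -/
theorem IsResolution.exists_filler {X : AugSimplicial C} (hX : IsResolution X) (b : ℕ) {W : C}
    (x : ∀ {a : ℕ} (ζ : Fin a →o Fin b), ¬ Function.Surjective ζ → (W ⟶ X.deg a))
    (hx : ∀ {a a' : ℕ} (ζ : Fin a →o Fin b) (hζ : ¬ Function.Surjective ζ) (η : Fin a' →o Fin a),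
      x ζ hζ ≫ X.map (AugOrd.ofHom η).op =
        x (ζ.comp η) fun h => hζ fun y => (h y).imp' η fun _ => id) :
    ∃ (W' : C) (p : W' ⟶ W) (z : W' ⟶ X.deg b), IsRegularEpi p ∧
      ∀ {a : ℕ} (ζ : Fin a →o Fin b) (hζ : ¬ Function.Surjective ζ),
        z ≫ X.map (AugOrd.ofHom ζ).op = p ≫ x ζ hζ := by
  have hδ : ∀ {b : ℕ} (j : Fin (b + 1)),
      ¬ Function.Surjective (Fin.succAboveOrderEmb j).toOrderHom :=
    fun j h => (Fin.exists_succAbove_eq_iff.1 (h j)) rfl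
  cases b with
  | zero =>
    -- the family is empty, and any morphism serves as a filler
    exact ⟨W, 𝟙 W, 0, inferInstance, fun ζ hζ => absurd (fun y => y.elim0) hζ⟩
  | succ b =>
    suffices ∃ (W' : C) (p : W' ⟶ W) (z : W' ⟶ X.deg (b + 1)), IsRegularEpi p ∧
        ∀ j, z ≫ face X j = p ≫ x _ (hδ j) by
      obtain ⟨W', p, z, hp, hz⟩ := this
      refine ⟨W', p, z, hp, fun ζ hζ => ?_⟩
      have hζ' := hζ
      simp only [Function.Surjective, not_forall, not_exists] at hζ'
      obtain ⟨j, hj⟩ := hζ'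
      obtain ⟨θ, rfl⟩ := exists_comp_eq_of_forall_ne ζ j hj
      rw [map_ofHom_comp, ← hx _ (hδ j), ← Category.assoc, ← Category.assoc, ← hz]
      rfl
    cases b with
    | zero =>
      obtain ⟨W', p, z, hp, hz⟩ := exists_lift_of_isRegularEpi hX.zero (x _ (hδ 0))
      refine ⟨W', p, z, hp, fun j => ?_⟩
      obtain rfl : j = 0 := Fin.fin_one_eq_zero j
      exact hz
    | succ m =>
      let c : W ⟶ Cycles X m := FaceFamilies.lift (fun j => x _ (hδ j.1)) (by
        intro i j hij _ _
        refine (hx _ (hδ j.succ) _).trans (Eq.trans ?_ (hx _ (hδ i.castSucc) _).symm)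
        congr 1
        apply OrderHom.ext
        funext y
        change j.succ.succAbove (i.succAbove y) = i.castSucc.succAbove (j.succAbove y)
        simp only [Fin.ext_iff, val_succAbove, Fin.val_succ, Fin.val_castSucc, Fin.le_def] at hij ⊢
        split_ifs <;> omega)
      obtain ⟨W', p, z, hp, hz⟩ := exists_lift_of_isRegularEpi (hX.succ m) c
      refine ⟨W', p, z, hp, fun j => ?_⟩
      have h := congrArg (· ≫ FaceFamilies.proj X ⟨j, Finset.mem_univ j⟩) hz
      simp only [Category.assoc, toFaceFamilies, c, FaceFamilies.lift_proj] at h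
      exact h.trans (congrArg (p ≫ ·) (FaceFamilies.lift_proj _ _ _))

theorem IsResolution.exists_filler_card {X : AugSimplicial C} (hX : IsResolution X) {n : ℕ}
    {I : Finset (Fin n)} {W : C} (x : ∀ J, J < I → (W ⟶ X.deg J.card))
    (hx : ∀ {J K} (hJ : J < I) (hKJ : K ≤ J),
      x J hJ ≫ X.map (AugOrd.ofHom (cardHom hKJ)).op = x K (hKJ.trans_lt hJ)) :
    ∃ (W' : C) (p : W' ⟶ W) (z : W' ⟶ X.deg I.card), IsRegularEpi p ∧
      ∀ J (hJ : J < I), z ≫ X.map (AugOrd.ofHom (cardHom hJ.le)).op = p ≫ x J hJ := by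
  -- the smallest subset `J` over which a non-surjective function to `I` is defined
  let im : ∀ {a : ℕ}, (Fin a →o Fin I.card) → Finset (Fin n) := fun ζ =>
    Finset.univ.image ((ofCard I).comp ζ)
  have mem_im : ∀ {a : ℕ} (ζ : Fin a →o Fin I.card) (y : Fin a), (ofCard I).comp ζ y ∈ im ζ :=
    fun ζ y => Finset.mem_image_of_mem _ (Finset.mem_univ y)
  have im_le : ∀ {a : ℕ} (ζ : Fin a →o Fin I.card) (J : Finset (Fin n)),
      (∀ y, (ofCard I).comp ζ y ∈ J) → im ζ ≤ J := fun ζ J h i hi => by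
    obtain ⟨y, -, rfl⟩ := Finset.mem_image.1 hi
    exact h y
  have im_lt : ∀ {a : ℕ} (ζ : Fin a →o Fin I.card), ¬ Function.Surjective ζ → im ζ < I := by
    refine fun ζ hζ => lt_of_le_of_ne (im_le ζ I fun y => ofCard_mem I _) fun h => hζ fun y => ?_
    obtain ⟨z, -, hz⟩ := Finset.mem_image.1 (h.symm ▸ ofCard_mem I y : ofCard I y ∈ im ζ)
    exact ⟨z, ofCard_injective I hz⟩
  have hxJ : ∀ {a : ℕ} (ζ : Fin a →o Fin I.card) (hζ : im ζ < I) (J : Finset (Fin n)) (hJ : J < I)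
      (h : ∀ y, (ofCard I).comp ζ y ∈ J),
      x J hJ ≫ X.map (AugOrd.ofHom (toCard J _ h)).op =
        x (im ζ) hζ ≫ X.map (AugOrd.ofHom (toCard (im ζ) _ (mem_im ζ))).op := by
    intro a ζ hζ J hJ h
    rw [← hx hJ (im_le ζ J h), Category.assoc, ← map_ofHom_comp, cardHom_comp_toCard]
  obtain ⟨W', p, z, hp, hz⟩ := hX.exists_filler I.card
    (fun ζ hζ => x (im ζ) (im_lt ζ hζ) ≫ X.map (AugOrd.ofHom (toCard (im ζ) _ (mem_im ζ))).op)
    (fun ζ hζ η => by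
      rw [Category.assoc, ← map_ofHom_comp, ← hxJ (ζ.comp η) _ (im ζ) (im_lt ζ hζ)
        fun y => mem_im ζ (η y)]
      rfl)
  refine ⟨W', p, z, hp, fun J hJ => ?_⟩
  have hns : ¬ Function.Surjective (cardHom hJ.le) := fun hs => by
    refine hJ.not_ge fun i hi => ?_
    obtain ⟨y, rfl⟩ := exists_ofCard_eq hi
    obtain ⟨w, rfl⟩ := hs y
    have := DFunLike.congr_fun (ofCard_comp_cardHom hJ.le) w
    exact (show ofCard I (cardHom hJ.le w) = ofCard J w from this) ▸ ofCard_mem J w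
  have hmem : ∀ y, (ofCard I).comp (cardHom hJ.le) y ∈ J := fun y => by
    rw [ofCard_comp_cardHom]; exact ofCard_mem J y
  rw [hz _ hns, ← hxJ _ _ J hJ hmem]
  have : toCard J _ hmem = OrderHom.id :=
    ofCard_comp_injective ((ofCard_comp_toCard _ _ _).trans (ofCard_comp_cardHom _))
  rw [this, map_ofHom_id, Category.comp_id]

theorem IsResolution.hasLocalFillers {X : AugSimplicial C} (hX : IsResolution X) (n : ℕ) :
    HasLocalFillers (underlyingCube n X) :=
  fun _ _ x => hX.exists_filler_card x.val x.val_restr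

end Resolution

/-! ### Torsors are H-central cubic extensions -/

section HCentral

variable {C : Type u} [Category.{v} C] [HasZeroMorphisms C]

theorem kernelInter_arrow_comp [HasFiniteLimits C] {n : ℕ} (F : Cube C n) {I : Finset (Fin n)}
    {i : Fin n} (hi : i ∈ I) : (kernelInter F I).arrow ≫ initialArrow F i = 0 := by
  have h : kernelInter F I ≤ kernelSubobject (initialArrow F i) := Finset.inf_le hi
  rw [← Subobject.ofLE_arrow h, Category.assoc, kernelSubobject_arrow_comp, comp_zero]

/-- Under the order isomorphism of `{0, …, m}` and `{0, …, |univ| - 1}`, the initial arrows of the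
underlying higher arrow become the face operators. -/
theorem comp_map_toCard_face_eq_zero {X : AugSimplicial C} {m : ℕ} {K : C}
    {k : K ⟶ X.deg (Finset.univ : Finset (Fin (m + 1))).card} {i : Fin (m + 1)}
    (h : k ≫ X.map (AugOrd.ofHom (cardHom (Finset.erase_subset i Finset.univ))).op = 0) :
    (k ≫ X.map (AugOrd.ofHom (toCard Finset.univ OrderHom.id fun _ => Finset.mem_univ _)).op) ≫
      face X i = 0 := by
  have hi : ∀ y, (Fin.succAboveOrderEmb i).toOrderHom y ∈ Finset.univ.erase i := fun y =>
    Finset.mem_erase.2 ⟨Fin.succAbove_ne i y, Finset.mem_univ _⟩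
  have : (toCard Finset.univ OrderHom.id fun _ => Finset.mem_univ _).comp
      (Fin.succAboveOrderEmb i).toOrderHom =
      (cardHom (Finset.erase_subset i Finset.univ)).comp (toCard _ _ hi) :=
    (cardHom_comp_toCard _ _ hi).symm
  rw [Category.assoc, face, ← map_ofHom_comp, this, map_ofHom_comp, ← Category.assoc, h, zero_comp]

variable [SemiAbelian C] [CartesianMonoidalCategory C] [BraidedCategory C]

theorem Torsor.cooperates_card {Z A : C} [AddGrpObj A] [IsCommAddMonObj A] {m : ℕ}
    (T : Torsor Z A (m + 1)) (I : Finset (Fin (m + 1))) {K L : C}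
    {k : K ⟶ T.obj.deg (Finset.univ : Finset (Fin (m + 1))).card}
    {l : L ⟶ T.obj.deg (Finset.univ : Finset (Fin (m + 1))).card}
    (hk : ∀ i ∈ I,
      k ≫ T.obj.map (AugOrd.ofHom (cardHom (Finset.erase_subset i Finset.univ))).op = 0)
    (hl : ∀ i ∉ I,
      l ≫ T.obj.map (AugOrd.ofHom (cardHom (Finset.erase_subset i Finset.univ))).op = 0) :
    Cooperates k l := by
  have h := (T.cooperates I (fun i hi => comp_map_toCard_face_eq_zero (hk i hi))
    (fun i hi => comp_map_toCard_face_eq_zero (hl i hi))).comp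
    (T.obj.map (AugOrd.ofHom (ofCard Finset.univ)).op)
  have hid : (toCard (Finset.univ : Finset (Fin (m + 1))) OrderHom.id
      fun _ => Finset.mem_univ _).comp (ofCard Finset.univ) = OrderHom.id :=
    toCard_ofCard _
  rwa [Category.assoc, Category.assoc, ← map_ofHom_comp, hid, map_ofHom_id, Category.comp_id,
    Category.comp_id] at h

theorem Torsor.isHCentral {Z A : C} [AddGrpObj A] [IsCommAddMonObj A] {m : ℕ}
    (T : Torsor Z A (m + 1)) : IsHCentral (underlyingCube (m + 1) T.obj) := by
  refine ⟨(T.isResolution.hasLocalFillers _).isCubicExtension, fun I => ?_⟩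
  exact Cooperates.isHuqCommutator_bot (T.cooperates_card I
    (fun i hi => kernelInter_arrow_comp (underlyingCube (m + 1) T.obj) hi)
    (fun i hi => kernelInter_arrow_comp (underlyingCube (m + 1) T.obj) (Finset.mem_compl.2 hi)))

end HCentral

end

end HigherTorsors

theorem mainTheorem6 {C : Type u} [Category.{v} C] [HasZeroMorphisms C] [HigherTorsors.SemiAbelian C]
    [CartesianMonoidalCategory C] [BraidedCategory C] (n : ℕ) (hn : 1 ≤ n) (Z A : C)
    [AddGrpObj A] [IsCommAddMonObj A] (T : HigherTorsors.Torsor Z A n) :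
    HigherTorsors.IsHCentral (HigherTorsors.underlyingCube n T.obj) := by
  obtain ⟨m, rfl⟩ := Nat.exists_eq_add_of_le' hn
  exact T.isHCentral
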